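/- Notation. $K\ge 1$ is the number of categories, $p$ the number of discriminants, $N_k\ge 0$ the number of observations in category $k$, and $Y_k\in\mathbb R^{N_k\times p}$ the matrix whose rows are these observations. $I_n$ is the identity matrix, $J_n$ the $n\times n$ matrix of ones, $\mathbf 1_n$ the vector of ones, $|A|$ the determinant, and $\Gamma_p(a)=\pi^{p(p-1)/4}\prod_{j=1}^p\Gamma\big(a+\tfrac{1-j}{2}\big)$. The hyperparameters are $\eta_k\in\mathbb R^p$, symmetric positive definite $\Psi_k\in\mathbb R^{p\times p}$, real $\nu_k>p-1$ and $\alpha_k>0$. The inverse Wishart distribution $IW(\Psi,\nu)$ has the density $$\frac{|\Psi|^{\nu/2}}{2^{\nu p/2}\,\Gamma_p(\nu/2)}\,|\Sigma|^{-(\nu+p+1)/2}\,e^{-\frac12\mathrm{tr}(\Psi\Sigma^{-1})}$$ on positive definite matrices $\Sigma$, with respect to Lebesgue measure in the $p(p+1)/2$ free entries. The matrix t-distribution $T_{n\times p}(m,M,S,\Omega)$ has the density $$\frac{\Gamma_p\big(\tfrac12(n+m+p-1)\big)}{\pi^{np/2}\,\Gamma_p\big(\tfrac12(m+p-1)\big)}\,|S|^{-p/2}\,|\Omega|^{-n/2}\,\big|I_n+S^{-1}(T-M)\Omega^{-1}(T-M)^\top\big|^{-(n+m+p-1)/2}.$$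 The multivariate t-distribution $t_\nu(\mu,S)$ on $\mathbb R^q$ has the density $$\frac{\Gamma((\nu+q)/2)}{(\pi\nu)^{q/2}\,\Gamma(\nu/2)}\,|S|^{-1/2}\Big[1+\tfrac1\nu(t-\mu)^\top S^{-1}(t-\mu)\Big]^{-(\nu+q)/2}.$$ Model. The category probabilities $\pi$ have the prior $\mathrm{Dir}(\alpha_1,\dots,\alpha_K)$. Independently of $\pi$ and over $k$, $\Sigma_k\sim IW(\Psi_k,\nu_k)$ and $\mu_k\mid\Sigma_k\sim N(\eta_k,\Sigma_k)$. The categories of the training data are known, and given the parameters the likelihood is $\prod_{k=1}^K\prod_{i=1}^{N_k}\pi_k\,N(y_k^i;\mu_k,\Sigma_k)$, where $y_k^i$ is the $i$-th row of $Y_k$ and $N(\cdot\,;\mu,\Sigma)$ is the normal density. Given the parameters, a new event has category $\tilde z=k$ with probability $\pi_k$, and then discriminants $\tilde y\sim N(\mu_k,\Sigma_k)$. Posteriors are given by Bayes' rule; predictive laws are obtained by integrating over the posterior. Put $\bar y_k=Y_k^\top\mathbf 1_{N_k}/N_k$ (with $N_k\bar y_k=0$ if $N_k=0$), $\tilde\nu_k=N_k+\nu_k+1-p$,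 $\tilde\mu_k=(N_k\bar y_k+\eta_k)/(N_k+1)$ and $$\tilde\Sigma_k=\frac{N_k+2}{(N_k+1)(N_k+\nu_k+1-p)}\Big(\Psi_k+(Y_k-\mathbf 1_{N_k}\eta_k^\top)^\top\big(I_{N_k}-\tfrac1{N_k+1}J_{N_k}\big)(Y_k-\mathbf 1_{N_k}\eta_k^\top)\Big).$$ Theorem. 1. For every $k$, the marginal law of the data $Y_k$ of category $k$ ($N_k$ rows drawn independently from $N(\mu_k,\Sigma_k)$, with $(\mu_k,\Sigma_k)$ drawn from its prior) is $T_{N_k\times p}(\nu_k+1-p,\ \mathbf 1_{N_k}\eta_k^\top,\ I_{N_k}+J_{N_k},\ \Psi_k)$. The marginal likelihood $\iint \prod_i N(y_k^i;\mu,\Sigma)\,p(\mu,\Sigma)\,d\mu\,d\Sigma$ equals the density of this distribution at every $Y_k$. 2. For every $k$ and every $Y_k$, the predictive law of a new observation of category $k$, that is, the integral of $N(\mu_k,\Sigma_k)$ over the posterior of $(\mu_k,\Sigma_k)$ given $Y_k$, is $t_{\tilde\nu_k}(\tilde\mu_k,\tilde\Sigma_k)$. If only some of the $p$ discriminants of the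 new observation are recorded, their predictive law is the multivariate t-distribution with the same degrees of freedom, and with the location and scale obtained by deleting the entries of the other discriminants from $\tilde\mu_k$ and $\tilde\Sigma_k$. 3. For all data $Y=(Y_1,\dots,Y_K)$, the joint posterior of $(\pi,(\mu_k,\Sigma_k)_k)$ is the product of $\mathrm{Dir}(N_1+\alpha_1,\dots,N_K+\alpha_K)$ and of the posteriors of $(\mu_k,\Sigma_k)$ given $Y_k$, over $k=1,\dots,K$. The predictive category probabilities are $$P(\tilde z=k\mid Y)=\frac{N_k+\alpha_k}{\sum_{j=1}^K(N_j+\alpha_j)}.$$ Given $Y$ and $\tilde z=k$, the new event $\tilde y$ has the law $t_{\tilde\nu_k}(\tilde\mu_k,\tilde\Sigma_k)$. The total predictive law of $\tilde y$, or of any selection of its discriminants, is the mixture, with weights $P(\tilde z=k\mid Y)$, of the laws in part 2. -/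

import Mathlib

open MeasureTheory ProbabilityTheory Matrix
open scoped ENNReal

noncomputable section

/-- Multivariate gamma function
`Γ_p(a) = π ^ (p (p - 1) / 4) * ∏_{j = 1}^{p} Γ (a + (1 - j) / 2)`. -/
def multivariateGamma (p : ℕ) (a : ℝ) : ℝ :=
  Real.pi ^ ((p : ℝ) * ((p : ℝ) - 1) / 4) * ∏ j : Fin p, Real.Gamma (a - (j : ℝ) / 2)

/-- The symmetric matrix with free entries `x`, one for every unordered pair of indices.
Integration over symmetric matrices is integration over these `p (p + 1) / 2` free entries. -/
def symMatrix {p : ℕ} (x : Sym2 (Fin p) → ℝ) : Matrix (Fin p) (Fin p) ℝ :=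
  Matrix.of fun i j => x s(i, j)

/-- Density at `y` of the normal distribution with mean `μ` and (positive definite)
covariance matrix `S`. -/
def normalPDF {p : ℕ} (μ : Fin p → ℝ) (S : Matrix (Fin p) (Fin p) ℝ) (y : Fin p → ℝ) : ℝ :=
  (2 * Real.pi) ^ (-(p : ℝ) / 2) * S.det ^ (-(1 / 2) : ℝ) *
    Real.exp (-((y - μ) ⬝ᵥ (S⁻¹ *ᵥ (y - μ))) / 2)

/-- The normal distribution with mean `μ` and covariance matrix `S`, as a measure on `ℝᵖ`. -/
def normalLaw {p : ℕ} (μ : Fin p → ℝ) (S : Matrix (Fin p) (Fin p) ℝ) : Measure (Fin p → ℝ) :=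
  (multivariateGaussian (WithLp.toLp 2 μ) S).map WithLp.ofLp

open Classical in
/-- Density at `S` of the inverse Wishart distribution with scale matrix `Ψ` and `ν` degrees of
freedom, with respect to Lebesgue measure on the free entries; it is supported on the positive
definite matrices. -/
def invWishartPDF {p : ℕ} (Ψ : Matrix (Fin p) (Fin p) ℝ) (ν : ℝ)
    (S : Matrix (Fin p) (Fin p) ℝ) : ℝ :=
  if S.PosDef then
    Ψ.det ^ (ν / 2) / ((2 : ℝ) ^ (ν * p / 2) * multivariateGamma p (ν / 2)) *
      S.det ^ (-(ν + p + 1) / 2) * Real.exp (-(Ψ * S⁻¹).trace / 2)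
  else 0

/-- Density at `T` of the matrix variate t-distribution `T_{n × p}(m, M, S, Ω)`. -/
def matrixTPDF {n p : ℕ} (m : ℝ) (M : Matrix (Fin n) (Fin p) ℝ) (S : Matrix (Fin n) (Fin n) ℝ)
    (Ω : Matrix (Fin p) (Fin p) ℝ) (T : Matrix (Fin n) (Fin p) ℝ) : ℝ :=
  multivariateGamma p ((n + m + p - 1) / 2) /
      (Real.pi ^ ((n : ℝ) * p / 2) * multivariateGamma p ((m + p - 1) / 2)) *
    S.det ^ (-(p : ℝ) / 2) * Ω.det ^ (-(n : ℝ) / 2) *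
    (1 + S⁻¹ * (T - M) * Ω⁻¹ * (T - M)ᵀ).det ^ (-(n + m + p - 1) / 2)

/-- The matrix variate t-distribution `T_{n × p}(m, M, S, Ω)`, as a measure on `n × p` arrays. -/
def matrixTLaw {n p : ℕ} (m : ℝ) (M : Matrix (Fin n) (Fin p) ℝ) (S : Matrix (Fin n) (Fin n) ℝ)
    (Ω : Matrix (Fin p) (Fin p) ℝ) : Measure (Fin n → Fin p → ℝ) :=
  volume.withDensity fun T => ENNReal.ofReal (matrixTPDF m M S Ω (Matrix.of T))

/-- Density at `t` of the multivariate t-distribution with `ν` degrees of freedom, location `μ`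
and scale matrix `S`. -/
def multivariateTPDF {q : ℕ} (ν : ℝ) (μ : Fin q → ℝ) (S : Matrix (Fin q) (Fin q) ℝ)
    (t : Fin q → ℝ) : ℝ :=
  Real.Gamma ((ν + q) / 2) / ((Real.pi * ν) ^ ((q : ℝ) / 2) * Real.Gamma (ν / 2)) *
    S.det ^ (-(1 / 2) : ℝ) *
    (1 + (1 / ν) * ((t - μ) ⬝ᵥ (S⁻¹ *ᵥ (t - μ)))) ^ (-(ν + q) / 2)

/-- The multivariate t-distribution, as a measure on `ℝ^q`. -/
def multivariateTLaw {q : ℕ} (ν : ℝ) (μ : Fin q → ℝ) (S : Matrix (Fin q) (Fin q) ℝ) :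
    Measure (Fin q → ℝ) :=
  volume.withDensity fun t => ENNReal.ofReal (multivariateTPDF ν μ S t)

/-- Lebesgue measure on the open probability simplex of `ℝ^K`, that is, Lebesgue measure in all
coordinates but the first, which is one minus the sum of the others. -/
def simplexVolume : (K : ℕ) → Measure (Fin K → ℝ)
  | 0 => 0
  | K + 1 =>
    ((volume : Measure (Fin K → ℝ)).restrict {x | (∀ i, 0 < x i) ∧ ∑ i, x i < 1}).map
      fun x => Fin.cons (1 - ∑ i, x i) x

/-- The Dirichlet distribution with parameter vector `α`. -/
def dirichletLaw {K : ℕ} (α : Fin K → ℝ) : Measure (Fin K → ℝ) :=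
  (simplexVolume K).withDensity fun w =>
    ENNReal.ofReal (Real.Gamma (∑ k, α k) * ∏ k, (w k ^ (α k - 1) / Real.Gamma (α k)))

/-- Bayes' rule: the posterior distribution of a parameter with prior distribution `prior`,
when the likelihood of the observed data is the function `L` of the parameter. -/
def posteriorLaw {Θ : Type*} [MeasurableSpace Θ] (prior : Measure Θ) (L : Θ → ℝ≥0∞) : Measure Θ :=
  (∫⁻ θ, L θ ∂prior)⁻¹ • prior.withDensity L

/-- The parameters `(μ, Σ)` of one category; the covariance `Σ` is given by its free entries. -/
abbrev CategoryParam (p : ℕ) : Type := (Fin p → ℝ) × (Sym2 (Fin p) → ℝ)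

/-- The covariance matrix of one category. -/
def CategoryParam.cov {p : ℕ} (θ : CategoryParam p) : Matrix (Fin p) (Fin p) ℝ :=
  symMatrix θ.2

/-- The prior of one category: `μ | Σ ∼ N(η, Σ)` and `Σ ∼ IW(Ψ, ν)`. -/
def niwPrior {p : ℕ} (η : Fin p → ℝ) (Ψ : Matrix (Fin p) (Fin p) ℝ) (ν : ℝ) :
    Measure (CategoryParam p) :=
  volume.withDensity fun θ =>
    ENNReal.ofReal (normalPDF η θ.cov θ.1) * ENNReal.ofReal (invWishartPDF Ψ ν θ.cov)

/-- The likelihood of `n` independent observations (the rows of `Y`) from `N(μ, Σ)`. -/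
def categoryLikelihood {n p : ℕ} (Y : Matrix (Fin n) (Fin p) ℝ) (θ : CategoryParam p) : ℝ≥0∞ :=
  ∏ i, ENNReal.ofReal (normalPDF θ.1 θ.cov (Y i))

/-- The marginal likelihood of the data `Y` of one category: the likelihood integrated over the
prior. -/
def marginalLikelihood {n p : ℕ} (η : Fin p → ℝ) (Ψ : Matrix (Fin p) (Fin p) ℝ) (ν : ℝ)
    (Y : Matrix (Fin n) (Fin p) ℝ) : ℝ≥0∞ :=
  ∫⁻ θ, categoryLikelihood Y θ ∂(niwPrior η Ψ ν)

/-- The marginal law of `n` observations of one category: draw `(μ, Σ)` from the prior, then `n`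
independent rows from `N(μ, Σ)`. -/
def marginalDataLaw {p : ℕ} (n : ℕ) (η : Fin p → ℝ) (Ψ : Matrix (Fin p) (Fin p) ℝ) (ν : ℝ) :
    Measure (Fin n → Fin p → ℝ) :=
  (niwPrior η Ψ ν).bind fun θ => Measure.pi fun _ : Fin n => normalLaw θ.1 θ.cov

/-- The posterior of the parameters of one category, given its data `Y`. -/
def niwPosterior {n p : ℕ} (η : Fin p → ℝ) (Ψ : Matrix (Fin p) (Fin p) ℝ) (ν : ℝ)
    (Y : Matrix (Fin n) (Fin p) ℝ) : Measure (CategoryParam p) :=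
  posteriorLaw (niwPrior η Ψ ν) (categoryLikelihood Y)

/-- The predictive law of a new observation of one category, given its data `Y`. -/
def predictiveLaw {n p : ℕ} (η : Fin p → ℝ) (Ψ : Matrix (Fin p) (Fin p) ℝ) (ν : ℝ)
    (Y : Matrix (Fin n) (Fin p) ℝ) : Measure (Fin p → ℝ) :=
  (niwPosterior η Ψ ν Y).bind fun θ => normalLaw θ.1 θ.cov

/-- The mean of each column of the data. -/
def columnMean {n p : ℕ} (Y : Matrix (Fin n) (Fin p) ℝ) : Fin p → ℝ :=
  (n : ℝ)⁻¹ • (Yᵀ *ᵥ 1)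

/-- The location vector `(n ȳ + η) / (n + 1)`. -/
def predictiveLocation {n p : ℕ} (η : Fin p → ℝ) (Y : Matrix (Fin n) (Fin p) ℝ) : Fin p → ℝ :=
  ((n : ℝ) + 1)⁻¹ • ((n : ℝ) • columnMean Y + η)

/-- The `m × n` matrix all of whose entries are one. -/
def onesMatrix (m n : ℕ) : Matrix (Fin m) (Fin n) ℝ := Matrix.of fun _ _ => 1

/-- The `n × p` matrix `1 ηᵀ`, all of whose rows are `η`. -/
def constRows {p : ℕ} (n : ℕ) (η : Fin p → ℝ) : Matrix (Fin n) (Fin p) ℝ :=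
  Matrix.vecMulVec 1 η

/-- The scale matrix
`(n + 2) / ((n + 1) (n + ν + 1 - p)) (Ψ + (Y - 1 ηᵀ)ᵀ (I - J / (n + 1)) (Y - 1 ηᵀ))`. -/
def predictiveScale {n p : ℕ} (η : Fin p → ℝ) (Ψ : Matrix (Fin p) (Fin p) ℝ) (ν : ℝ)
    (Y : Matrix (Fin n) (Fin p) ℝ) : Matrix (Fin p) (Fin p) ℝ :=
  (((n : ℝ) + 2) / (((n : ℝ) + 1) * (n + ν + 1 - p))) •
    (Ψ + (Y - constRows n η)ᵀ * (1 - ((n : ℝ) + 1)⁻¹ • onesMatrix n n) * (Y - constRows n η))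

/-- All parameters of the mixture model: the category probabilities `π` and the parameters of
each of the `K` categories. -/
abbrev ModelParam (K p : ℕ) : Type := (Fin K → ℝ) × (Fin K → CategoryParam p)

/-- The prior of the mixture model: `π ∼ Dir(α)`, and independently for each category
`(μ_k, Σ_k)` is normal-inverse-Wishart. -/
def modelPrior {K p : ℕ} (α : Fin K → ℝ) (η : Fin K → Fin p → ℝ)
    (Ψ : Fin K → Matrix (Fin p) (Fin p) ℝ) (ν : Fin K → ℝ) : Measure (ModelParam K p) :=
  (dirichletLaw α).prod (Measure.pi fun k => niwPrior (η k) (Ψ k) (ν k))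

/-- The likelihood of the data of all categories: each of the `N k` observations of category `k`
contributes the factor `π_k N(y; μ_k, Σ_k)`. -/
def modelLikelihood {K p : ℕ} {N : Fin K → ℕ} (Y : (k : Fin K) → Matrix (Fin (N k)) (Fin p) ℝ)
    (θ : ModelParam K p) : ℝ≥0∞ :=
  ∏ k, ∏ i, ENNReal.ofReal (θ.1 k) * ENNReal.ofReal (normalPDF (θ.2 k).1 (θ.2 k).cov (Y k i))

/-- The joint posterior of all parameters, given the data of all categories. -/
def modelPosterior {K p : ℕ} {N : Fin K → ℕ} (α : Fin K → ℝ) (η : Fin K → Fin p → ℝ)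
    (Ψ : Fin K → Matrix (Fin p) (Fin p) ℝ) (ν : Fin K → ℝ)
    (Y : (k : Fin K) → Matrix (Fin (N k)) (Fin p) ℝ) : Measure (ModelParam K p) :=
  posteriorLaw (modelPrior α η Ψ ν) (modelLikelihood Y)

/-- The joint law of the category and the discriminants of a new event when the parameters are
`θ`: the category is `k` with probability `π_k`, and then the discriminants are
`N(μ_k, Σ_k)`-distributed. -/
def newEventLaw {K p : ℕ} (θ : ModelParam K p) : Measure (Fin K × (Fin p → ℝ)) :=
  ∑ k, ENNReal.ofReal (θ.1 k) • (Measure.dirac k).prod (normalLaw (θ.2 k).1 (θ.2 k).cov)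

/-- The joint predictive law of the category and the discriminants of a new event, given the data
of all categories. -/
def newEventPredictiveLaw {K p : ℕ} {N : Fin K → ℕ} (α : Fin K → ℝ) (η : Fin K → Fin p → ℝ)
    (Ψ : Fin K → Matrix (Fin p) (Fin p) ℝ) (ν : Fin K → ℝ)
    (Y : (k : Fin K) → Matrix (Fin (N k)) (Fin p) ℝ) : Measure (Fin K × (Fin p → ℝ)) :=
  (modelPosterior α η Ψ ν Y).bind newEventLaw

end

/-! ### Products and mixtures of measures with densities -/

/-! The engine is conjugacy. At a positive definite `Σ`, completing the square in `μ` writes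
likelihood times `N(μ; η, Σ)` as a constant times `|Σ|^(-n/2) exp(-tr(A Σ⁻¹)/2)` times a normal
density in `μ` with covariance `Σ/(n+1)`, where `A` is the scatter matrix
(`prod_normalPDF_mul_normalPDF`). The last factor integrates to one. The rest, times the inverse
Wishart kernel with parameters `(Ψ, ν)`, is the kernel with parameters `(Ψ + A, ν + n)`. So the
marginal likelihood is a quotient of normalizing constants (`marginalLikelihood_eq`).

Those constants come from `lintegral_invWishartKernel`, by induction on `p`. For a matrix with lower
block `D`, first column `Dβ` and Schur complement `s`, the kernel factors into an inverse gamma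
function of `s`, a Gaussian in `β`, and a kernel of size `p` with `ν - 1` in place of `ν`.

The matrix t density is this marginal likelihood rewritten with `(I + J)⁻¹ = I - J/(n+1)`, `|I + J|
= n + 1` and `|1 + AB| = |1 + BA|`. The predictive density is the marginal likelihood of the data
with one more row, divided by that of the data. The extra row changes the scatter matrix by rank
one, so the matrix determinant lemma produces the multivariate t kernel, and the multivariate gamma
functions telescope (`marginalLikelihood_cons_div`). For partial observations, the t law is written
as a gamma mixture of normal laws, whose coordinate projections are normal with the corresponding
submatrix as covariance.

In the mixture model, prior and likelihood are both products of a function of `π` and functions of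
the single `(μ_k, Σ_k)`, hence so is the posterior. The `π`-part is a Dirichlet density times a
monomial, again Dirichlet up to a constant, and its means are the category probabilities. The
remaining claims follow from the value of the joint predictive law on measurable sets
(`newEventPredictiveLaw_apply`).

Normal laws have densities only at positive definite covariance, which holds almost surely under
prior and posterior. Measurability and densities are therefore handled almost everywhere. -/

theorem lintegral_pi_prod_eq_prod_lintegral {n : ℕ} {X : Fin n → Type*}
    [∀ i, MeasurableSpace (X i)] (μ : ∀ i, Measure (X i)) [∀ i, SigmaFinite (μ i)]
    (f : ∀ i, X i → ℝ≥0∞) (hf : ∀ i, Measurable (f i)) :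
    ∫⁻ x, ∏ i, f i (x i) ∂(Measure.pi μ) = ∏ i, ∫⁻ x, f i x ∂(μ i) := by
  induction n with
  | zero => simp
  | succ n ih =>
    have hF : Measurable fun z : ∀ j : Fin n, X j.succ => ∏ i, f i.succ (z i) :=
      Finset.measurable_prod _ fun i _ => (hf i.succ).comp (measurable_pi_apply i)
    have h := (measurePreserving_piFinSuccAbove μ 0).lintegral_comp_emb
      (MeasurableEquiv.measurableEmbedding _) (fun z => f 0 z.1 * ∏ i : Fin n, f i.succ (z.2 i))
    simp only [Fin.prod_univ_succ]
    rw [← ih (fun i => μ i.succ) (fun i => f i.succ) (fun i => hf _)]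
    rw [← lintegral_prod_mul (hf 0).aemeasurable hF.aemeasurable]
    exact h

theorem pi_withDensity {n : ℕ} {X : Fin n → Type*}
    [∀ i, MeasurableSpace (X i)] (μ : ∀ i, Measure (X i)) [∀ i, SigmaFinite (μ i)]
    (f : ∀ i, X i → ℝ≥0∞) (hf : ∀ i, Measurable (f i))
    (hσ : ∀ i, SigmaFinite ((μ i).withDensity (f i))) :
    Measure.pi (fun i => (μ i).withDensity (f i)) =
      (Measure.pi μ).withDensity fun x => ∏ i, f i (x i) := by
  refine Measure.pi_eq fun s hs => ?_
  rw [withDensity_apply _ (MeasurableSet.univ_pi hs), Measure.restrict_pi_pi,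
    lintegral_pi_prod_eq_prod_lintegral _ _ hf]
  exact Finset.prod_congr rfl fun i _ => (withDensity_apply _ (hs i)).symm

/-- Meant for families of normal laws, which are known to have a jointly measurable density only at
almost every parameter. Almost everywhere measurability is all that `Measure.bind` needs. -/
theorem aemeasurable_of_ae_eq_withDensity {Θ E : Type*} [MeasurableSpace Θ] [MeasurableSpace E]
    {m : Measure Θ} {ρ : Measure E} [SFinite ρ] {κ : Θ → Measure E} {f : Θ → E → ℝ≥0∞}
    (hf : Measurable (Function.uncurry f)) (hκ : ∀ᵐ θ ∂m, κ θ = ρ.withDensity (f θ)) :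
    AEMeasurable κ m := by
  refine ⟨fun θ => ρ.withDensity (f θ), ?_, hκ⟩
  refine Measure.measurable_of_measurable_coe _ fun s hs => ?_
  simp only [withDensity_apply _ hs]
  exact hf.lintegral_prod_right'

/-- Tonelli: a mixture of laws with densities has the averaged density. -/
theorem bind_withDensity_of_ae_eq {Θ E : Type*} [MeasurableSpace Θ] [MeasurableSpace E]
    {m : Measure Θ} [SFinite m] {ρ : Measure E} [SFinite ρ] {κ : Θ → Measure E}
    {f : Θ → E → ℝ≥0∞} (hf : Measurable (Function.uncurry f))
    (hκ : ∀ᵐ θ ∂m, κ θ = ρ.withDensity (f θ)) :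
    m.bind κ = ρ.withDensity fun y => ∫⁻ θ, f θ y ∂m := by
  ext s hs
  rw [Measure.bind_apply hs (aemeasurable_of_ae_eq_withDensity hf hκ), withDensity_apply _ hs,
    lintegral_lintegral_swap]
  · refine lintegral_congr_ae ?_
    filter_upwards [hκ] with θ hθ
    rw [hθ, withDensity_apply _ hs]
  · exact (hf.comp measurable_swap).aemeasurable

theorem measure_map_bind {Θ E F : Type*} [MeasurableSpace Θ] [MeasurableSpace E] [MeasurableSpace F]
    {m : Measure Θ} {κ : Θ → Measure E} (hκ : AEMeasurable κ m) {g : E → F} (hg : Measurable g) :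
    (m.bind κ).map g = m.bind fun θ => (κ θ).map g := by
  ext s hs
  have h : AEMeasurable (fun θ => (κ θ).map g) m :=
    (Measure.measurable_map g hg).comp_aemeasurable hκ
  rw [Measure.map_apply hg hs, Measure.bind_apply (hg hs) hκ, Measure.bind_apply hs h]
  exact lintegral_congr fun θ => (Measure.map_apply hg hs).symm

theorem lintegral_comp_add_mulVec {p : ℕ} {M : Matrix (Fin p) (Fin p) ℝ} (hM : M.det ≠ 0)
    (μ : Fin p → ℝ) {F : (Fin p → ℝ) → ℝ≥0∞} (hF : Measurable F) :
    ENNReal.ofReal |M.det| * ∫⁻ z, F (μ + M *ᵥ z) = ∫⁻ x, F x := by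
  have hL : Measurable (toLin' M) := (LinearMap.continuous_of_finiteDimensional _).measurable
  have h := lintegral_map (μ := volume) (hF.comp (measurable_const_add μ)) hL
  rw [Real.map_matrix_volume_pi_eq_smul_volume_pi hM, lintegral_smul_measure] at h
  have h2 : ∫⁻ x, F x = ∫⁻ a, (F ∘ fun x => μ + x) a :=
    (lintegral_add_left_eq_self F μ).symm
  rw [← h2] at h
  simp only [Function.comp_apply, toLin'_apply, smul_eq_mul] at h
  rw [← h, ← mul_assoc, ← ENNReal.ofReal_mul (abs_nonneg _), ← abs_mul, mul_inv_cancel₀ hM]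
  simp

/-! ### The multivariate normal distribution -/

section Normal
open scoped MatrixOrder

theorem normalLaw_eq_map {p : ℕ} (μ : Fin p → ℝ) (S : Matrix (Fin p) (Fin p) ℝ) :
    normalLaw μ S = (Measure.pi fun _ : Fin p => gaussianReal 0 1).map
      fun z => μ + CFC.sqrt S *ᵥ z := by
  rw [normalLaw, multivariateGaussian, ← map_pi_eq_stdGaussian, Measure.map_map, Measure.map_map]
  · rfl
  all_goals fun_prop

instance isProbabilityMeasure_normalLaw {p : ℕ} (μ : Fin p → ℝ) (S : Matrix (Fin p) (Fin p) ℝ) :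
    IsProbabilityMeasure (normalLaw μ S) :=
  Measure.isProbabilityMeasure_map (by fun_prop)

theorem normalPDF_nonneg {p : ℕ} (μ : Fin p → ℝ) {S : Matrix (Fin p) (Fin p) ℝ}
    (hS : 0 ≤ S.det) (y : Fin p → ℝ) : 0 ≤ normalPDF μ S y := by
  unfold normalPDF; positivity

theorem continuous_normalPDF {p : ℕ} (μ : Fin p → ℝ) (S : Matrix (Fin p) (Fin p) ℝ) :
    Continuous (normalPDF μ S) := by
  unfold normalPDF; fun_prop

/-- With `R` the square root of `S`, the law is the image of independent standard normals under `z ↦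
μ + R z`. The Jacobian is `det R = (det S)^(1/2)`, and the quadratic form of `S⁻¹` at `R z` is the
sum of the `z i ^ 2`. -/
theorem normalLaw_eq_withDensity {p : ℕ} (μ : Fin p → ℝ) {S : Matrix (Fin p) (Fin p) ℝ}
    (hS : S.PosDef) :
    normalLaw μ S = volume.withDensity fun y => ENNReal.ofReal (normalPDF μ S y) := by
  set R := CFC.sqrt S with hR
  have hRR : R * R = S := CFC.sqrt_mul_sqrt_self _ hS.posSemidef.nonneg
  have hRpsd : R.PosSemidef := (CFC.sqrt_nonneg S).posSemidef
  have hRt : Rᵀ = R := by simpa using hRpsd.isHermitian.eq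
  have hdet : R.det ^ 2 = S.det := by rw [← hRR, det_mul, sq]
  have hR0 : 0 < R.det := by
    refine lt_of_le_of_ne hRpsd.det_nonneg fun h => ?_
    rw [← h] at hdet
    exact hS.det_pos.ne' (by simpa using hdet.symm)
  have hinv : S⁻¹ = R⁻¹ * R⁻¹ := by rw [← hRR, Matrix.mul_inv_rev]
  have hunit : IsUnit R.det := hR0.ne'.isUnit
  have hpi : (Measure.pi fun _ : Fin p => gaussianReal 0 1) =
      volume.withDensity fun z => ∏ i, gaussianPDF 0 1 (z i) := by
    have : ∀ i : Fin p, SigmaFinite ((volume : Measure ℝ).withDensity (gaussianPDF 0 1)) := by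
      intro i
      rw [← gaussianReal_of_var_ne_zero 0 one_ne_zero]; infer_instance
    have h := pi_withDensity (fun _ : Fin p => (volume : Measure ℝ)) (fun _ => gaussianPDF 0 1)
      (fun _ => measurable_gaussianPDF 0 1) this
    rw [← gaussianReal_of_var_ne_zero 0 one_ne_zero] at h
    exact h
  have hm : Measurable fun z : Fin p → ℝ => μ + R *ᵥ z :=
    Continuous.measurable (by fun_prop)
  have hg : Measurable fun z : Fin p → ℝ => ∏ i, gaussianPDF 0 1 (z i) :=
    Finset.measurable_prod _ fun i _ =>
      (measurable_gaussianPDF 0 1).comp (measurable_pi_apply i)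
  ext s hs
  -- Both measures of `s` become integrals of indicators over the whole space, so that the affine
  -- substitution can be applied to the right-hand one.
  rw [normalLaw_eq_map, Measure.map_apply hm hs, hpi, withDensity_apply _ (hm hs),
    withDensity_apply _ hs, ← lintegral_indicator hs, ← lintegral_indicator (hm hs),
    ← lintegral_comp_add_mulVec hR0.ne' μ (Measurable.indicator
      (continuous_normalPDF μ S).measurable.ennreal_ofReal hs),
    ← lintegral_const_mul _ ((Measurable.indicator
      (continuous_normalPDF μ S).measurable.ennreal_ofReal hs).fun_comp hm)]
  refine lintegral_congr fun z => ?_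
  by_cases hz : μ + R *ᵥ z ∈ s
  · rw [Set.indicator_of_mem (by exact hz), Set.indicator_of_mem hz,
      ← ENNReal.ofReal_mul (abs_nonneg _)]
    simp only [gaussianPDF]
    rw [← ENNReal.ofReal_prod_of_nonneg fun i _ => gaussianPDFReal_nonneg _ _ _]
    congr 1
    have hq : (R *ᵥ z) ⬝ᵥ (S⁻¹ *ᵥ (R *ᵥ z)) = ∑ i, z i ^ 2 := by
      rw [hinv, mulVec_mulVec, Matrix.mul_assoc, nonsing_inv_mul _ hunit, Matrix.mul_one,
        dotProduct_mulVec, vecMul_mulVec, ← mulVec_transpose, hRt,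
        mul_nonsing_inv _ hunit, transpose_one, one_mulVec]
      simp [dotProduct, sq]
    have hd : S.det ^ (-(1 / 2) : ℝ) = R.det⁻¹ := by
      rw [← hdet, ← Real.rpow_natCast, ← Real.rpow_mul hR0.le, ← Real.rpow_neg_one]
      norm_num
    simp only [normalPDF, add_sub_cancel_left, hq, hd, gaussianPDFReal, Finset.prod_mul_distrib,
      ← Real.exp_sum, abs_of_pos hR0]
    simp only [Finset.prod_const, Finset.card_univ, Fintype.card_fin, NNReal.coe_one, mul_one,
      sub_zero, Finset.sum_neg_distrib, ← Finset.sum_div, neg_div]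
    have hpow : (√(2 * Real.pi))⁻¹ ^ p = (2 * Real.pi) ^ (-((p : ℝ) / 2)) := by
      rw [Real.sqrt_eq_rpow, ← Real.rpow_neg (by positivity), ← Real.rpow_natCast,
        ← Real.rpow_mul (by positivity)]
      ring_nf
    rw [hpow]
    field_simp
  · rw [Set.indicator_of_notMem (by exact hz), Set.indicator_of_notMem hz, mul_zero]

theorem lintegral_normalPDF {p : ℕ} (μ : Fin p → ℝ) {S : Matrix (Fin p) (Fin p) ℝ}
    (hS : S.PosDef) : ∫⁻ y, ENNReal.ofReal (normalPDF μ S y) = 1 := by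
  have h : normalLaw μ S Set.univ = 1 := measure_univ
  rwa [normalLaw_eq_withDensity μ hS, withDensity_apply _ .univ, Measure.restrict_univ] at h

/-- Characteristic functions: selecting coordinates is a linear map `Pᵀ`, so it replaces the
frequency `t` by `P t`, and `Pᵀ S P` is the submatrix. -/
theorem normalLaw_map_comp {p q : ℕ} (μ : Fin p → ℝ) {S : Matrix (Fin p) (Fin p) ℝ}
    (hS : S.PosDef) (e : Fin q ↪ Fin p) :
    (normalLaw μ S).map (fun y j => y (e j)) =
      normalLaw (fun j => μ (e j)) (S.submatrix e e) := by
  let L : EuclideanSpace ℝ (Fin p) → EuclideanSpace ℝ (Fin q) :=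
    fun x => WithLp.toLp 2 fun j => x (e j)
  have hL : Measurable L := by fun_prop
  have key : (multivariateGaussian (WithLp.toLp 2 μ) S).map L =
      multivariateGaussian (WithLp.toLp 2 fun j => μ (e j)) (S.submatrix e e) := by
    have : IsProbabilityMeasure ((multivariateGaussian (WithLp.toLp 2 μ) S).map L) :=
      Measure.isProbabilityMeasure_map hL.aemeasurable
    refine Measure.ext_of_charFun (funext fun t => ?_)
    let P : Matrix (Fin p) (Fin q) ℝ := Matrix.of fun i j => if e j = i then 1 else 0
    have hP : ∀ x : Fin p → ℝ, (fun j => x (e j)) = Pᵀ *ᵥ x := by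
      intro x; ext j
      simp [mulVec, dotProduct, P]
    have hinner : ∀ x : EuclideanSpace ℝ (Fin p),
        inner ℝ (L x) t = inner ℝ x (WithLp.toLp 2 (P *ᵥ t.ofLp)) := by
      intro x
      simp only [EuclideanSpace.inner_eq_star_dotProduct, star_trivial, L]
      rw [hP, mulVec_transpose, ← dotProduct_comm, ← dotProduct_mulVec,dotProduct_comm]
    have hsub : S.submatrix e e = Pᵀ * S * P := by
      ext i j
      simp [Matrix.mul_apply, P]
    rw [charFun_apply, integral_map hL.aemeasurable (by fun_prop)]
    simp only [hinner]
    rw [← charFun_apply, charFun_multivariateGaussian hS.posSemidef,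
      charFun_multivariateGaussian (hS.submatrix e.injective).posSemidef]
    congr 2
    · rw [real_inner_comm, ← hinner, real_inner_comm]
    · congr 1
      rw [hsub, ← mulVec_mulVec, ← mulVec_mulVec, dotProduct_mulVec _ Pᵀ, vecMul_transpose]
  rw [normalLaw, normalLaw, ← key, Measure.map_map (by fun_prop) (by fun_prop),
    Measure.map_map (by fun_prop) hL]
  rfl

end Normal

/-! ### Measurability on the space of symmetric matrices -/

theorem symMatrix_transpose {p : ℕ} (x : Sym2 (Fin p) → ℝ) : (symMatrix x)ᵀ = symMatrix x := by
  ext i j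
  simp [symMatrix, Sym2.eq_swap]

theorem continuous_symMatrix {p : ℕ} : Continuous (symMatrix (p := p)) := by
  unfold symMatrix
  exact continuous_matrix fun i j => continuous_apply _

-- Positive definite means positive semidefinite and nonsingular. The first is an intersection of
-- closed conditions, one for each vector, hence closed although the family is uncountable; the
-- second is open.
open scoped MatrixOrder in
theorem measurableSet_posDef_symMatrix {p : ℕ} :
    MeasurableSet {x : Sym2 (Fin p) → ℝ | (symMatrix x).PosDef} := by
  have h : {x : Sym2 (Fin p) → ℝ | (symMatrix x).PosDef} =
      (⋂ v : Fin p → ℝ, {x | 0 ≤ v ⬝ᵥ (symMatrix x *ᵥ v)}) ∩ {x | (symMatrix x).det ≠ 0} := by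
    ext x
    have hH : (symMatrix x).IsHermitian := by
      rw [Matrix.IsHermitian, conjTranspose_eq_transpose_of_trivial, symMatrix_transpose]
    simp only [Set.mem_inter_iff, Set.mem_iInter, Set.mem_ofPred_eq]
    constructor
    · exact fun h => ⟨fun v => by simpa using h.posSemidef.dotProduct_mulVec_nonneg v,
        h.det_pos.ne'⟩
    · rintro ⟨h1, h2⟩
      refine (PosSemidef.posDef_iff_det_ne_zero ?_).2 h2
      exact PosSemidef.of_dotProduct_mulVec_nonneg hH fun v => by simpa using h1 v
  have hc : Continuous (symMatrix (p := p)) := continuous_symMatrix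
  rw [h]
  refine (isClosed_iInter fun v => ?_).measurableSet.inter ?_
  · exact isClosed_le continuous_const (by fun_prop)
  · exact (isOpen_ne_fun (by fun_prop) continuous_const).measurableSet

theorem measurable_symMatrix_inv_apply {p : ℕ} (i j : Fin p) :
    Measurable fun x : Sym2 (Fin p) → ℝ => (symMatrix x)⁻¹ i j := by
  have hc : Continuous (symMatrix (p := p)) := continuous_symMatrix
  have h1 : Measurable fun x : Sym2 (Fin p) → ℝ => (symMatrix x).det :=
    hc.matrix_det.measurable
  have h2 : Measurable fun x : Sym2 (Fin p) → ℝ => (symMatrix x).adjugate i j :=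
    (hc.matrix_adjugate.matrix_elem i j).measurable
  -- Since the inverse of zero is zero, the formula adjugate over determinant also covers singular
  -- matrices.
  simp only [Matrix.inv_def, Ring.inverse_eq_inv', Matrix.smul_apply, smul_eq_mul]
  exact h1.inv.mul h2

theorem measurable_det_symMatrix {p : ℕ} :
    Measurable fun x : Sym2 (Fin p) → ℝ => (symMatrix x).det :=
  continuous_symMatrix.matrix_det.measurable

theorem measurable_trace_mul_symMatrix_inv {p : ℕ} (Ψ : Matrix (Fin p) (Fin p) ℝ) :
    Measurable fun x : Sym2 (Fin p) → ℝ => (Ψ * (symMatrix x)⁻¹).trace := by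
  simp only [Matrix.trace, Matrix.diag, Matrix.mul_apply]
  exact Finset.measurable_sum _ fun i _ => Finset.measurable_sum _ fun j _ =>
    (measurable_symMatrix_inv_apply j i).const_mul _

open Classical in
/-- The inverse Wishart density without its normalizing constant. -/
noncomputable def invWishartKernel {p : ℕ} (Ψ : Matrix (Fin p) (Fin p) ℝ) (ν : ℝ)
    (S : Matrix (Fin p) (Fin p) ℝ) : ℝ :=
  if S.PosDef then S.det ^ (-(ν + p + 1) / 2) * Real.exp (-(Ψ * S⁻¹).trace / 2) else 0

theorem measurable_invWishartKernel {p : ℕ} (Ψ : Matrix (Fin p) (Fin p) ℝ) (ν : ℝ) :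
    Measurable fun x : Sym2 (Fin p) → ℝ => invWishartKernel Ψ ν (symMatrix x) := by
  unfold invWishartKernel
  refine Measurable.ite measurableSet_posDef_symMatrix ?_ measurable_const
  have h1 := measurable_det_symMatrix (p := p)
  have h2 := measurable_trace_mul_symMatrix_inv Ψ
  fun_prop

/-! ### Splitting off the first row and column of a symmetric matrix -/

/-- Unordered pairs in `Fin (p + 1)` are the pair `(0, 0)`, the pairs `(0, i + 1)`, and the
unordered pairs of nonzero indices. -/
noncomputable def sym2FinSuccEquiv (p : ℕ) :
    Unit ⊕ (Fin p ⊕ Sym2 (Fin p)) ≃ Sym2 (Fin (p + 1)) :=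
  Equiv.ofBijective
    (Sum.elim (fun _ => s(0, 0)) (Sum.elim (fun i => s(0, i.succ)) (Sym2.map Fin.succ))) <| by
    constructor
    · have h0 : ∀ (i : Fin (p + 1)) (z : Sym2 (Fin p)), s(0, i) ≠ z.map Fin.succ := by
        intro i z h
        have : (0 : Fin (p + 1)) ∈ z.map Fin.succ := h ▸ Sym2.mem_mk_left 0 i
        obtain ⟨k, -, hk⟩ := Sym2.mem_map.1 this
        exact Fin.succ_ne_zero k hk
      rintro (_ | i | z) (_ | j | w) h
      · rfl
      · simp [Fin.succ_ne_zero, eq_comm] at h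
      · exact absurd h (h0 _ _)
      · simp [Fin.succ_ne_zero] at h
      · simpa [Fin.succ_ne_zero] using h
      · exact absurd h (h0 _ _)
      · exact absurd h.symm (h0 _ _)
      · exact absurd h.symm (h0 _ _)
      · simpa using Sym2.map.injective (Fin.succ_injective p) h
    · intro z
      induction z with | _ i j
      induction i using Fin.cases with
      | zero =>
        induction j using Fin.cases with
        | zero => exact ⟨.inl (), rfl⟩
        | succ j => exact ⟨.inr (.inl j), rfl⟩
      | succ i =>
        induction j using Fin.cases with
        | zero => exact ⟨.inr (.inl i), Sym2.eq_swap⟩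
        | succ j => exact ⟨.inr (.inr s(i, j)), rfl⟩

/-- The free entries of the symmetric matrix with corner entry `a`, remaining first column `b`,
and remaining block `x`. -/
noncomputable def symCons {p : ℕ} (a : ℝ) (b : Fin p → ℝ) (x : Sym2 (Fin p) → ℝ) :
    Sym2 (Fin (p + 1)) → ℝ :=
  fun z => Sum.elim (fun _ => a) (Sum.elim b x) ((sym2FinSuccEquiv p).symm z)

theorem symCons_apply_sym2FinSuccEquiv {p : ℕ} (a : ℝ) (b : Fin p → ℝ) (x : Sym2 (Fin p) → ℝ)
    (w : Unit ⊕ (Fin p ⊕ Sym2 (Fin p))) :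
    symCons a b x (sym2FinSuccEquiv p w) = Sum.elim (fun _ => a) (Sum.elim b x) w := by
  simp [symCons]

theorem measurable_symCons {p : ℕ} :
    Measurable fun w : ℝ × (Fin p → ℝ) × (Sym2 (Fin p) → ℝ) => symCons w.1 w.2.1 w.2.2 := by
  refine measurable_pi_iff.2 fun z => ?_
  unfold symCons
  rcases (sym2FinSuccEquiv p).symm z with _ | i | z
  · exact measurable_fst
  · exact (measurable_pi_apply i).comp (measurable_fst.comp measurable_snd)
  · exact (measurable_pi_apply z).comp (measurable_snd.comp measurable_snd)

/-- Relabelling coordinates preserves Lebesgue measure. The order of integration, with the corner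
entry innermost, is the one that the Schur complement substitution needs. -/
theorem lintegral_symCons {p : ℕ} {F : (Sym2 (Fin (p + 1)) → ℝ) → ℝ≥0∞} (hF : Measurable F) :
    ∫⁻ x, F x = ∫⁻ x : Sym2 (Fin p) → ℝ, ∫⁻ b : Fin p → ℝ, ∫⁻ a : ℝ, F (symCons a b x) := by
  let e1 := (MeasurableEquiv.piCongrLeft (fun _ => ℝ) (sym2FinSuccEquiv p))
  let e2 := (MeasurableEquiv.sumPiEquivProdPi fun _ : Unit ⊕ (Fin p ⊕ Sym2 (Fin p)) => ℝ)
  let e3 := (MeasurableEquiv.sumPiEquivProdPi fun _ : Fin p ⊕ Sym2 (Fin p) => ℝ)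
  have h1 : MeasurePreserving e1 := volume_measurePreserving_piCongrLeft _ _
  have h2 : MeasurePreserving e2.symm := volume_measurePreserving_sumPiEquivProdPi_symm _
  have h3 : MeasurePreserving e3.symm := volume_measurePreserving_sumPiEquivProdPi_symm _
  have h4 : MeasurePreserving (MeasurableEquiv.funUnique Unit ℝ).symm :=
    (volume_preserving_funUnique Unit ℝ).symm _
  have h5 := h1.comp (h2.comp (h4.prod h3))
  have hfun : (e1 ∘ e2.symm ∘ Prod.map (MeasurableEquiv.funUnique Unit ℝ).symm e3.symm) =
      fun w : ℝ × (Fin p → ℝ) × (Sym2 (Fin p) → ℝ) => symCons w.1 w.2.1 w.2.2 := by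
    funext w z
    obtain ⟨y, rfl⟩ := (sym2FinSuccEquiv p).surjective z
    rw [symCons_apply_sym2FinSuccEquiv]
    simp only [Function.comp_apply, e1]
    rw [MeasurableEquiv.coe_piCongrLeft, Equiv.piCongrLeft_apply_apply]
    rcases y with _ | i | z <;> rfl
  rw [hfun] at h5
  have hG : Measurable fun w : ℝ × (Fin p → ℝ) × (Sym2 (Fin p) → ℝ) =>
      F (symCons w.1 w.2.1 w.2.2) := hF.comp measurable_symCons
  rw [← h5.lintegral_comp hF]
  change ∫⁻ w, F (symCons w.1 w.2.1 w.2.2) ∂((volume : Measure ℝ).prod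
    ((volume : Measure (Fin p → ℝ)).prod (volume : Measure (Sym2 (Fin p) → ℝ)))) = _
  rw [lintegral_prod_symm _ hG.aemeasurable, lintegral_prod_symm _
    (Measurable.aemeasurable (Measurable.lintegral_prod_left' hG))]

/-- `Fin (p + 1)` as the index set of a block decomposition with a corner of size one. -/
def sumFinSuccEquiv (p : ℕ) : Unit ⊕ Fin p ≃ Fin (p + 1) :=
  (Equiv.sumComm _ _).trans ((Equiv.optionEquivSumPUnit _).symm.trans (finSuccEquiv p).symm)

theorem sumFinSuccEquiv_inl (p : ℕ) (u : Unit) : sumFinSuccEquiv p (.inl u) = 0 := rfl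

theorem sumFinSuccEquiv_inr (p : ℕ) (i : Fin p) : sumFinSuccEquiv p (.inr i) = i.succ := rfl

theorem symMatrix_symCons_submatrix {p : ℕ} (a : ℝ) (b : Fin p → ℝ) (x : Sym2 (Fin p) → ℝ) :
    (symMatrix (symCons a b x)).submatrix (sumFinSuccEquiv p) (sumFinSuccEquiv p) =
      fromBlocks (Matrix.of fun _ _ => a) (replicateRow Unit b) (replicateCol Unit b)
        (symMatrix x) := by
  have h := symCons_apply_sym2FinSuccEquiv a b x
  ext i j
  rcases i with _ | i <;> rcases j with _ | j <;>
    simp only [submatrix_apply, sumFinSuccEquiv_inl, sumFinSuccEquiv_inr, symMatrix, of_apply,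
      fromBlocks_apply₁₁, fromBlocks_apply₁₂, fromBlocks_apply₂₁, fromBlocks_apply₂₂,
      replicateRow_apply, replicateCol_apply]
  · exact h (.inl ())
  · exact h (.inr (.inl j))
  · rw [Sym2.eq_swap]; exact h (.inr (.inl i))
  · exact h (.inr (.inr s(i, j)))

/-! ### Block factorization of symmetric matrices -/

section Block
variable {n : Type*} [Fintype n] [DecidableEq n]

/-- The unitriangular block matrix with first row `(1, β)`. -/
def unitriangularBlock (β : n → ℝ) : Matrix (Unit ⊕ n) (Unit ⊕ n) ℝ :=
  fromBlocks 1 (replicateRow Unit β) 0 1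

theorem unitriangularBlock_mul (β γ : n → ℝ) :
    unitriangularBlock β * unitriangularBlock γ = unitriangularBlock (γ + β) := by
  simp [unitriangularBlock, fromBlocks_multiply, replicateRow_add]

theorem det_unitriangularBlock (β : n → ℝ) : (unitriangularBlock β).det = 1 := by
  simp [unitriangularBlock]

/-- The symmetric block matrix with lower right block `D` and Schur complement `s`, whose first
column is `D *ᵥ β`. -/
def schurBlock (s : ℝ) (β : n → ℝ) (D : Matrix n n ℝ) : Matrix (Unit ⊕ n) (Unit ⊕ n) ℝ :=
  fromBlocks (Matrix.of fun _ _ => s + β ⬝ᵥ (D *ᵥ β)) (replicateRow Unit (D *ᵥ β))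
    (replicateCol Unit (D *ᵥ β)) D

/-- The block diagonal matrix with blocks `s` and `D`. -/
def cornerBlock (s : ℝ) (D : Matrix n n ℝ) : Matrix (Unit ⊕ n) (Unit ⊕ n) ℝ :=
  fromBlocks (Matrix.of fun _ _ => s) 0 0 D

/-- This congruence to a block diagonal matrix yields the determinant, the positive definiteness
criterion and the inverse in the coordinates `(s, β, D)`. -/
theorem schurBlock_eq (s : ℝ) (β : n → ℝ) {D : Matrix n n ℝ} (hD : Dᵀ = D) :
    schurBlock s β D =
      unitriangularBlock β * cornerBlock s D * (unitriangularBlock β)ᵀ := by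
  have hv : β ᵥ* D = D *ᵥ β := by rw [← mulVec_transpose, hD]
  ext i j
  rcases i with _ | i <;> rcases j with _ | j <;>
    simp [schurBlock, unitriangularBlock, cornerBlock, fromBlocks_transpose, fromBlocks_multiply,
      Matrix.mul_apply, dotProduct, ← hv, vecMul, mul_comm]
  · simp [Matrix.one_apply]
  · exact Finset.sum_congr rfl fun k _ => by rw [← congrFun (congrFun hD k) i, transpose_apply]
  · simp [Matrix.one_apply]

theorem det_cornerBlock (s : ℝ) (D : Matrix n n ℝ) : (cornerBlock s D).det = s * D.det := by
  simp [cornerBlock, det_fromBlocks_zero₂₁]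

theorem det_schurBlock (s : ℝ) (β : n → ℝ) {D : Matrix n n ℝ} (hD : Dᵀ = D) :
    (schurBlock s β D).det = s * D.det := by
  rw [schurBlock_eq s β hD, det_mul, det_mul, det_transpose, det_unitriangularBlock,
    det_cornerBlock]
  ring

omit [DecidableEq n] in
theorem posDef_cornerBlock_iff (s : ℝ) (D : Matrix n n ℝ) :
    (cornerBlock s D).PosDef ↔ 0 < s ∧ D.PosDef := by
  constructor
  · intro h
    exact ⟨h.diag_pos (i := Sum.inl ()), h.submatrix Sum.inr_injective⟩
  · rintro ⟨hs, hD⟩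
    refine PosDef.of_dotProduct_mulVec_pos ?_ fun v hv => ?_
    · rw [cornerBlock, isHermitian_fromBlocks_iff]
      refine ⟨?_, by simp, by simp, hD.isHermitian⟩
      ext; simp
    · have h1 : star v ⬝ᵥ (cornerBlock s D *ᵥ v) =
          s * v (.inl ()) ^ 2 + (v ∘ Sum.inr) ⬝ᵥ (D *ᵥ (v ∘ Sum.inr)) := by
        rw [cornerBlock, fromBlocks_mulVec]
        simp [dotProduct, mulVec]
        ring
      rw [h1]
      have h2 := hD.posSemidef.dotProduct_mulVec_nonneg (v ∘ Sum.inr)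
      rw [star_trivial] at h2
      by_cases h : v ∘ Sum.inr = 0
      · have : v (.inl ()) ≠ 0 := by
          intro h0
          refine hv (funext fun i => ?_)
          rcases i with _ | i
          · exact h0
          · exact congrFun h i
        positivity
      · have h3 := hD.dotProduct_mulVec_pos h
        rw [star_trivial] at h3
        positivity

theorem posDef_schurBlock_iff (s : ℝ) (β : n → ℝ) {D : Matrix n n ℝ} (hD : Dᵀ = D) :
    (schurBlock s β D).PosDef ↔ 0 < s ∧ D.PosDef := by
  have hU : IsUnit (unitriangularBlock β) := by
    rw [isUnit_iff_isUnit_det, det_unitriangularBlock]; exact isUnit_one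
  rw [schurBlock_eq s β hD, ← posDef_cornerBlock_iff,
    ← IsUnit.posDef_star_right_conjugate_iff (x := cornerBlock s D) hU,
    star_eq_conjTranspose, conjTranspose_eq_transpose_of_trivial]

/-- Cycling the unitriangular factors of the inverse around the trace conjugates the first matrix,
which only shifts `γ` to `γ - β`. What remains is a trace against a block diagonal matrix. -/
theorem trace_schurBlock_mul_inv {σ s : ℝ} (γ β : n → ℝ) {Φ D : Matrix n n ℝ} (hΦ : Φᵀ = Φ)
    (hD : Dᵀ = D) (hs : s ≠ 0) (hd : D.det ≠ 0) :
    (schurBlock σ γ Φ * (schurBlock s β D)⁻¹).trace =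
      (σ + (γ - β) ⬝ᵥ (Φ *ᵥ (γ - β))) / s + (Φ * D⁻¹).trace := by
  have hUU : unitriangularBlock β * unitriangularBlock (-β) = 1 := by
    rw [unitriangularBlock_mul, neg_add_cancel]
    simp [unitriangularBlock]
  have hinv : (schurBlock s β D)⁻¹ = (unitriangularBlock (-β))ᵀ * cornerBlock s⁻¹ D⁻¹ *
      unitriangularBlock (-β) := by
    refine inv_eq_right_inv ?_
    have h1 : (unitriangularBlock β)ᵀ * (unitriangularBlock (-β))ᵀ = 1 := by
      rw [← transpose_mul, unitriangularBlock_mul, add_neg_cancel]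
      simp [unitriangularBlock]
    have h2 : cornerBlock s D * cornerBlock s⁻¹ D⁻¹ = 1 := by
      rw [cornerBlock, cornerBlock, fromBlocks_multiply, ← fromBlocks_one]
      congr 1
      · ext; simp [Matrix.mul_apply, hs]
      · simp
      · simp
      · simp [mul_nonsing_inv _ hd.isUnit]
    calc schurBlock s β D * ((unitriangularBlock (-β))ᵀ * cornerBlock s⁻¹ D⁻¹ *
          unitriangularBlock (-β))
        = unitriangularBlock β * (cornerBlock s D * ((unitriangularBlock β)ᵀ *
          (unitriangularBlock (-β))ᵀ) * cornerBlock s⁻¹ D⁻¹) * unitriangularBlock (-β) := by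
          rw [schurBlock_eq s β hD]; simp only [Matrix.mul_assoc]
      _ = 1 := by rw [h1, Matrix.mul_one, h2, Matrix.mul_one, hUU]
  have h3 : (schurBlock σ γ Φ * (schurBlock s β D)⁻¹).trace =
      (schurBlock σ (γ - β) Φ * cornerBlock s⁻¹ D⁻¹).trace := by
    rw [hinv, ← Matrix.mul_assoc, trace_mul_comm, schurBlock_eq _ _ hΦ, schurBlock_eq _ _ hΦ,
      sub_eq_add_neg, ← unitriangularBlock_mul, transpose_mul]
    simp only [Matrix.mul_assoc]
  rw [h3, schurBlock, cornerBlock, fromBlocks_multiply]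
  simp [Matrix.trace, Matrix.mul_apply, div_eq_mul_inv]

end Block

/-! ### The normalizing constant of the inverse Wishart distribution -/

/-- Up to its normalizing constant, the integrand is the normal density with mean `γ` and covariance
`s Φ⁻¹`. -/
theorem lintegral_exp_neg_quadratic {p : ℕ} {Φ : Matrix (Fin p) (Fin p) ℝ} (hΦ : Φ.PosDef)
    (γ : Fin p → ℝ) {s : ℝ} (hs : 0 < s) :
    ∫⁻ β, ENNReal.ofReal (Real.exp (-((γ - β) ⬝ᵥ (Φ *ᵥ (γ - β))) / (2 * s))) =
      ENNReal.ofReal ((2 * Real.pi * s) ^ ((p : ℝ) / 2) * Φ.det ^ (-(1 / 2) : ℝ)) := by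
  have hS : (s • Φ⁻¹).PosDef := hΦ.inv.smul hs
  have hinv : (s • Φ⁻¹)⁻¹ = s⁻¹ • Φ := by
    refine inv_eq_left_inv ?_
    rw [Matrix.smul_mul, Matrix.mul_smul, mul_nonsing_inv _ hΦ.det_pos.ne'.isUnit, smul_smul,
      inv_mul_cancel₀ hs.ne', one_smul]
  have hd := hΦ.det_pos
  have hc : 0 < (2 * Real.pi * s) ^ ((p : ℝ) / 2) * Φ.det ^ (-(1 / 2) : ℝ) := by positivity
  have hpdf : ∀ β, Real.exp (-((γ - β) ⬝ᵥ (Φ *ᵥ (γ - β))) / (2 * s)) =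
      ((2 * Real.pi * s) ^ ((p : ℝ) / 2) * Φ.det ^ (-(1 / 2) : ℝ)) *
        normalPDF γ (s • Φ⁻¹) β := by
    intro β
    have h1 : (s • Φ⁻¹).det ^ (-(1 / 2) : ℝ) = s ^ (-(p : ℝ) / 2) * Φ.det ^ (1 / 2 : ℝ) := by
      rw [det_smul, det_nonsing_inv, Ring.inverse_eq_inv', Fintype.card_fin,
        Real.mul_rpow (by positivity) (by positivity), ← Real.rpow_natCast, ← Real.rpow_mul hs.le,
        Real.inv_rpow hd.le, ← Real.rpow_neg hd.le]
      congr 2 <;> ring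
    have h2 : (β - γ) ⬝ᵥ (s⁻¹ • Φ) *ᵥ (β - γ) = (γ - β) ⬝ᵥ (Φ *ᵥ (γ - β)) / s := by
      rw [← neg_sub γ β, mulVec_neg, neg_dotProduct_neg, smul_mulVec, dotProduct_smul,
        smul_eq_mul, div_eq_inv_mul]
    have h3 : -((γ - β) ⬝ᵥ (Φ *ᵥ (γ - β)) / s) / 2 = -((γ - β) ⬝ᵥ (Φ *ᵥ (γ - β))) / (2 * s) := by
      field_simp
    rw [normalPDF, h1, hinv, h2, h3, Real.mul_rpow (by positivity) hs.le, neg_div 2 (p : ℝ),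
      Real.rpow_neg (x := 2 * Real.pi) (by positivity), Real.rpow_neg hs.le, Real.rpow_neg hd.le]
    field_simp
  simp_rw [hpdf, ENNReal.ofReal_mul hc.le]
  rw [lintegral_const_mul _ (continuous_normalPDF _ _).measurable.ennreal_ofReal,
    lintegral_normalPDF _ hS, mul_one]

theorem lintegral_rpow_mul_exp_neg_mul {a c : ℝ} (ha : 0 < a) (hc : 0 < c) :
    ∫⁻ t in Set.Ioi (0 : ℝ), ENNReal.ofReal (t ^ (a - 1) * Real.exp (-(c * t))) =
      ENNReal.ofReal (Real.Gamma a * c ^ (-a)) := by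
  rw [← ofReal_integral_eq_lintegral_ofReal]
  · rw [Real.integral_rpow_mul_exp_neg_mul_Ioi ha hc, one_div, Real.inv_rpow hc.le,
      Real.rpow_neg hc.le, mul_comm]
  · have := integrableOn_rpow_mul_exp_neg_mul_rpow (s := a - 1) (p := 1) (by linarith) one_pos hc
    change IntegrableOn _ _ _
    simpa [neg_mul] using this
  · filter_upwards [ae_restrict_mem measurableSet_Ioi] with t ht
    have : (0 : ℝ) < t := ht
    positivity

/-- The substitution `s ↦ s⁻¹` turns this inverse gamma integral into the gamma integral. -/
theorem lintegral_rpow_mul_exp_neg_div {a c : ℝ} (ha : 0 < a) (hc : 0 < c) :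
    ∫⁻ s in Set.Ioi (0 : ℝ), ENNReal.ofReal (s ^ (-(a + 1)) * Real.exp (-(c / s))) =
      ENNReal.ofReal (Real.Gamma a * c ^ (-a)) := by
  rw [← lintegral_rpow_mul_exp_neg_mul ha hc]
  have himg : (fun x : ℝ => x⁻¹) '' Set.Ioi 0 = Set.Ioi 0 := by
    ext x; constructor
    · rintro ⟨y, hy, rfl⟩; exact inv_pos.2 (Set.mem_Ioi.1 hy)
    · exact fun hx => ⟨x⁻¹, inv_pos.2 (Set.mem_Ioi.1 hx), inv_inv x⟩
  have h := lintegral_image_eq_lintegral_abs_deriv_mul (f := fun x : ℝ => x⁻¹)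
    (f' := fun x => -(x ^ 2)⁻¹) measurableSet_Ioi
    (fun x hx => (hasDerivAt_inv (ne_of_gt hx)).hasDerivWithinAt)
    (inv_injective.injOn) (fun t => ENNReal.ofReal (t ^ (a - 1) * Real.exp (-(c * t))))
  rw [himg] at h
  rw [h]
  refine setLIntegral_congr_fun measurableSet_Ioi fun s hs => ?_
  have hs : (0 : ℝ) < s := hs
  rw [← ENNReal.ofReal_mul (abs_nonneg _), abs_neg, abs_of_pos (by positivity), Real.inv_rpow hs.le,
    ← Real.rpow_neg hs.le, ← div_eq_mul_inv, ← mul_assoc]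
  congr 2
  rw [← Real.rpow_natCast, ← Real.rpow_neg hs.le, ← Real.rpow_add hs]
  congr 1
  push_cast; ring

theorem multivariateGamma_succ (p : ℕ) (a : ℝ) :
    multivariateGamma (p + 1) a =
      Real.pi ^ ((p : ℝ) / 2) * Real.Gamma a * multivariateGamma p (a - 1 / 2) := by
  rw [multivariateGamma, multivariateGamma, Fin.prod_univ_succ]
  have h1 : Real.pi ^ (((p + 1 : ℕ) : ℝ) * (((p + 1 : ℕ) : ℝ) - 1) / 4) =
      Real.pi ^ ((p : ℝ) / 2) * Real.pi ^ ((p : ℝ) * ((p : ℝ) - 1) / 4) := by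
    rw [← Real.rpow_add Real.pi_pos]; push_cast; ring_nf
  have h2 : ∀ j : Fin p, a - ((j.succ : ℕ) : ℝ) / 2 = a - 1 / 2 - (j : ℝ) / 2 := by
    intro j; push_cast [Fin.val_succ]; ring
  rw [h1]
  simp only [h2, Fin.val_zero, Nat.cast_zero, zero_div, sub_zero]
  ring

theorem multivariateGamma_pos {p : ℕ} {a : ℝ} (ha : ((p : ℝ) - 1) / 2 < a) :
    0 < multivariateGamma p a := by
  refine mul_pos (Real.rpow_pos_of_pos Real.pi_pos _)
    (Finset.prod_pos fun j _ => Real.Gamma_pos_of_pos ?_)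
  have : ((j : ℕ) : ℝ) + 1 ≤ p := by exact_mod_cast j.2
  linarith

/-- With `φ` the first column of `Ψ` below the corner, `γ = Φ⁻¹ φ`, and `σ` is the Schur complement
of `Φ`. -/
theorem schurBlock_eq_submatrix {p : ℕ} {Ψ : Matrix (Fin (p + 1)) (Fin (p + 1)) ℝ}
    (hΨ : Ψ.PosDef) : ∃ (σ : ℝ) (γ : Fin p → ℝ) (Φ : Matrix (Fin p) (Fin p) ℝ),
      0 < σ ∧ Φ.PosDef ∧
        Ψ.submatrix (sumFinSuccEquiv p) (sumFinSuccEquiv p) = schurBlock σ γ Φ := by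
  set Φ := Ψ.submatrix Fin.succ Fin.succ with hΦ
  have hΦpd : Φ.PosDef := hΨ.submatrix (Fin.succ_injective p)
  have hΦt : Φᵀ = Φ := by simpa using hΦpd.isHermitian.eq
  set φ : Fin p → ℝ := fun i => Ψ i.succ 0 with hφ
  have hγ : Φ *ᵥ (Φ⁻¹ *ᵥ φ) = φ := by
    rw [mulVec_mulVec, mul_nonsing_inv _ hΦpd.det_pos.ne'.isUnit, one_mulVec]
  have heq : Ψ.submatrix (sumFinSuccEquiv p) (sumFinSuccEquiv p) =
      schurBlock (Ψ 0 0 - (Φ⁻¹ *ᵥ φ) ⬝ᵥ φ) (Φ⁻¹ *ᵥ φ) Φ := by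
    rw [schurBlock, hγ]
    ext i j
    rcases i with _ | i <;> rcases j with _ | j
    · simp [sumFinSuccEquiv_inl]
    · have : Ψ 0 j.succ = Ψ j.succ 0 := by
        simpa using (hΨ.isHermitian.apply 0 j.succ).symm
      simpa [sumFinSuccEquiv_inl, sumFinSuccEquiv_inr] using this
    · simp [sumFinSuccEquiv_inl, sumFinSuccEquiv_inr, hφ]
    · simp [sumFinSuccEquiv_inr, hΦ]
  have hpd := hΨ.submatrix (sumFinSuccEquiv p).injective
  rw [heq] at hpd
  exact ⟨_, _, Φ, ((posDef_schurBlock_iff _ _ hΦt).1 hpd).1, hΦpd, heq⟩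

/-- The determinant is `s |D|`, the trace splits, and positive definiteness reduces to `s > 0`. So
the kernel separates into factors that can be integrated one after the other. -/
theorem invWishartKernel_symCons {p : ℕ} {Ψ : Matrix (Fin (p + 1)) (Fin (p + 1)) ℝ} {σ : ℝ}
    {γ : Fin p → ℝ} {Φ : Matrix (Fin p) (Fin p) ℝ} (hΦ : Φ.PosDef)
    (hΨ : Ψ.submatrix (sumFinSuccEquiv p) (sumFinSuccEquiv p) = schurBlock σ γ Φ) (ν : ℝ)
    {x : Sym2 (Fin p) → ℝ} (hx : (symMatrix x).PosDef) (s : ℝ) (β : Fin p → ℝ) :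
    invWishartKernel Ψ ν
        (symMatrix (symCons (s + β ⬝ᵥ (symMatrix x *ᵥ β)) (symMatrix x *ᵥ β) x)) =
      (Set.Ioi 0).indicator (fun s => (symMatrix x).det ^ (-(ν + (p + 1) + 1) / 2) *
        Real.exp (-(Φ * (symMatrix x)⁻¹).trace / 2) *
        (s ^ (-(ν + (p + 1) + 1) / 2) * Real.exp (-(σ / 2 / s)) *
        Real.exp (-((γ - β) ⬝ᵥ (Φ *ᵥ (γ - β))) / (2 * s)))) s := by
  set S := symMatrix (symCons (s + β ⬝ᵥ (symMatrix x *ᵥ β)) (symMatrix x *ᵥ β) x) with hS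
  have hΦt : Φᵀ = Φ := by simpa using hΦ.isHermitian.eq
  have hxt := symMatrix_transpose x
  have hb : S.submatrix (sumFinSuccEquiv p) (sumFinSuccEquiv p) = schurBlock s β (symMatrix x) :=
    symMatrix_symCons_submatrix _ _ _
  have hpd : S.PosDef ↔ 0 < s := by
    have h1 : S.PosDef ↔ (schurBlock s β (symMatrix x)).PosDef := by
      refine ⟨fun h => hb ▸ h.submatrix (sumFinSuccEquiv p).injective, fun h => ?_⟩
      rw [← hb] at h
      simpa using h.submatrix (sumFinSuccEquiv p).symm.injective
    rw [h1, posDef_schurBlock_iff _ _ hxt]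
    exact and_iff_left hx
  by_cases hs : 0 < s
  · have hdet : S.det = s * (symMatrix x).det := by
      rw [← det_submatrix_equiv_self (sumFinSuccEquiv p), hb, det_schurBlock _ _ hxt]
    have htr : (Ψ * S⁻¹).trace =
        (σ + (γ - β) ⬝ᵥ (Φ *ᵥ (γ - β))) / s + (Φ * (symMatrix x)⁻¹).trace := by
      rw [← trace_schurBlock_mul_inv γ β hΦt hxt hs.ne' hx.det_pos.ne', ← hb, ← hΨ,
        inv_submatrix_equiv, submatrix_mul_equiv]
      exact (Equiv.sum_comp (sumFinSuccEquiv p) fun i => (Ψ * S⁻¹) i i).symm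
    have hd := hx.det_pos
    rw [invWishartKernel, if_pos (hpd.2 hs), Set.indicator_of_mem (by exact hs), hdet, htr,
      Real.mul_rpow hs.le hd.le]
    push_cast
    have : Real.exp (-((σ + (γ - β) ⬝ᵥ Φ *ᵥ (γ - β)) / s + (Φ * (symMatrix x)⁻¹).trace) / 2) =
        Real.exp (-(Φ * (symMatrix x)⁻¹).trace / 2) * (Real.exp (-(σ / 2 / s)) *
        Real.exp (-((γ - β) ⬝ᵥ (Φ *ᵥ (γ - β))) / (2 * s))) := by
      rw [← Real.exp_add, ← Real.exp_add]
      congr 1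
      field_simp
      ring
    rw [this]
    ring
  · rw [invWishartKernel, if_neg (hpd.not.2 hs), Set.indicator_of_notMem (by exact hs)]

theorem invWishartKernel_symCons_of_not_posDef {p : ℕ}
    (Ψ : Matrix (Fin (p + 1)) (Fin (p + 1)) ℝ) (ν : ℝ) {x : Sym2 (Fin p) → ℝ}
    (hx : ¬(symMatrix x).PosDef) (a : ℝ) (b : Fin p → ℝ) :
    invWishartKernel Ψ ν (symMatrix (symCons a b x)) = 0 := by
  refine if_neg fun h => hx ?_
  have h1 := h.submatrix (sumFinSuccEquiv p).injective
  rw [symMatrix_symCons_submatrix] at h1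
  exact h1.submatrix Sum.inr_injective

theorem lintegral_invWishartKernel {p : ℕ} {Ψ : Matrix (Fin p) (Fin p) ℝ} (hΨ : Ψ.PosDef) {ν : ℝ}
    (hν : (p : ℝ) - 1 < ν) :
    ∫⁻ x, ENNReal.ofReal (invWishartKernel Ψ ν (symMatrix x)) =
      ENNReal.ofReal ((2 : ℝ) ^ (ν * p / 2) * multivariateGamma p (ν / 2) *
        Ψ.det ^ (-ν / 2)) := by
  induction p generalizing ν with
  -- There is only one `0 × 0` matrix, it is positive definite, and the space of free entries is a
  -- point of mass one.
  | zero =>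
    have hpd : ∀ S : Matrix (Fin 0) (Fin 0) ℝ, S.PosDef := fun S => by
      rw [Subsingleton.elim S Ψ]; exact hΨ
    have hvol : (volume : Measure (Sym2 (Fin 0) → ℝ)) Set.univ = 1 := by
      rw [volume_pi, Measure.pi_of_empty]; simp
    simp [invWishartKernel, hpd, multivariateGamma, Matrix.trace, hvol]
  | succ p ih =>
    obtain ⟨σ, γ, Φ, hσ, hΦ, hblock⟩ := schurBlock_eq_submatrix hΨ
    have hΦt : Φᵀ = Φ := by simpa using hΦ.isHermitian.eq
    have hdet : Ψ.det = σ * Φ.det := by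
      rw [← det_submatrix_equiv_self (sumFinSuccEquiv p), hblock, det_schurBlock _ _ hΦt]
    have hν0 : 0 < ν := by
      have : (0 : ℝ) ≤ p := Nat.cast_nonneg p
      push_cast at hν; linarith
    have hF : Measurable fun x : Sym2 (Fin (p + 1)) → ℝ =>
        ENNReal.ofReal (invWishartKernel Ψ ν (symMatrix x)) :=
      (measurable_invWishartKernel Ψ ν).ennreal_ofReal
    set c : ℝ := (2 * Real.pi) ^ ((p : ℝ) / 2) * Φ.det ^ (-(1 / 2) : ℝ) *
      (Real.Gamma (ν / 2) * (σ / 2) ^ (-(ν / 2))) with hc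
    have hΦd := hΦ.det_pos
    have hΓ : 0 < Real.Gamma (ν / 2) := Real.Gamma_pos_of_pos (by positivity)
    have hc0 : 0 ≤ c := by positivity
    have inner : ∀ x : Sym2 (Fin p) → ℝ,
        ∫⁻ b : Fin p → ℝ, ∫⁻ a : ℝ,
          ENNReal.ofReal (invWishartKernel Ψ ν (symMatrix (symCons a b x))) =
        ENNReal.ofReal c * ENNReal.ofReal (invWishartKernel Φ (ν - 1) (symMatrix x)) := by
      intro x
      by_cases hx : (symMatrix x).PosDef
      swap
      · simp only [invWishartKernel_symCons_of_not_posDef Ψ ν hx]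
        simp [invWishartKernel, hx]
      have hd := hx.det_pos
      have hG : Measurable fun b : Fin p → ℝ => ∫⁻ a : ℝ,
          ENNReal.ofReal (invWishartKernel Ψ ν (symMatrix (symCons a b x))) := by
        refine Measurable.lintegral_prod_right' (f := fun w : (Fin p → ℝ) × ℝ =>
          ENNReal.ofReal (invWishartKernel Ψ ν (symMatrix (symCons w.2 w.1 x)))) ?_
        exact hF.comp (measurable_symCons.comp
          (measurable_snd.prodMk (measurable_fst.prodMk measurable_const)))
      -- The column is substituted as `b = D β`, with Jacobian `det D`, where `D` is `symMatrix x`.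
      have h1 := lintegral_comp_add_mulVec hd.ne' 0 hG
      rw [← h1]
      simp only [zero_add]
      set e : ℝ := (symMatrix x).det ^ (-(ν + (p + 1) + 1) / 2) *
        Real.exp (-(Φ * (symMatrix x)⁻¹).trace / 2) with he
      have he0 : 0 ≤ e := by positivity
      have h2 : ∀ β : Fin p → ℝ, ∫⁻ a : ℝ,
          ENNReal.ofReal (invWishartKernel Ψ ν (symMatrix (symCons a (symMatrix x *ᵥ β) x))) =
          ∫⁻ s in Set.Ioi (0 : ℝ), ENNReal.ofReal e *
            (ENNReal.ofReal (s ^ (-(ν + (p + 1) + 1) / 2) * Real.exp (-(σ / 2 / s))) *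
            ENNReal.ofReal (Real.exp (-((γ - β) ⬝ᵥ (Φ *ᵥ (γ - β))) / (2 * s)))) := by
        intro β
        -- The corner is translated to `a = s + β ⬝ᵥ D β`, so that `s` is the Schur complement.
        rw [← lintegral_add_right_eq_self _ (β ⬝ᵥ (symMatrix x *ᵥ β)),
          ← lintegral_indicator measurableSet_Ioi]
        refine lintegral_congr fun s => ?_
        rw [invWishartKernel_symCons hΦ hblock ν hx]
        by_cases hs : s ∈ Set.Ioi (0 : ℝ)
        · have hs' : (0 : ℝ) < s := hs
          rw [Set.indicator_of_mem hs, Set.indicator_of_mem hs, ← he, ENNReal.ofReal_mul he0,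
            ENNReal.ofReal_mul (q := Real.exp (-((γ - β) ⬝ᵥ (Φ *ᵥ (γ - β))) / (2 * s)))
              (by positivity)]
        · simp [Set.indicator_of_notMem hs]
      simp_rw [h2]
      have h3 : Measurable fun w : (Fin p → ℝ) × ℝ =>
          ENNReal.ofReal e * (ENNReal.ofReal (w.2 ^ (-(ν + (p + 1) + 1) / 2) *
            Real.exp (-(σ / 2 / w.2))) *
            ENNReal.ofReal (Real.exp (-((γ - w.1) ⬝ᵥ (Φ *ᵥ (γ - w.1))) / (2 * w.2)))) := by
        have : Measurable fun w : (Fin p → ℝ) × ℝ => (γ - w.1) ⬝ᵥ (Φ *ᵥ (γ - w.1)) :=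
          Continuous.measurable (by fun_prop)
        fun_prop
      rw [lintegral_lintegral_swap h3.aemeasurable]
      have h4 : ∀ s ∈ Set.Ioi (0 : ℝ), ∫⁻ β : Fin p → ℝ, ENNReal.ofReal e *
            (ENNReal.ofReal (s ^ (-(ν + (p + 1) + 1) / 2) * Real.exp (-(σ / 2 / s))) *
            ENNReal.ofReal (Real.exp (-((γ - β) ⬝ᵥ (Φ *ᵥ (γ - β))) / (2 * s)))) =
          ENNReal.ofReal (e * ((2 * Real.pi) ^ ((p : ℝ) / 2) * Φ.det ^ (-(1 / 2) : ℝ))) *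
            ENNReal.ofReal (s ^ (-(ν / 2 + 1)) * Real.exp (-(σ / 2 / s))) := by
        intro s hs
        have hs : (0 : ℝ) < s := hs
        have hm : Measurable fun β : Fin p → ℝ =>
            ENNReal.ofReal (Real.exp (-((γ - β) ⬝ᵥ (Φ *ᵥ (γ - β))) / (2 * s))) :=
          (Continuous.measurable (by fun_prop)).ennreal_ofReal
        rw [lintegral_const_mul _ (hm.const_mul _), lintegral_const_mul _ hm,
          lintegral_exp_neg_quadratic hΦ γ hs, ← ENNReal.ofReal_mul (by positivity),
          ← ENNReal.ofReal_mul he0, ← ENNReal.ofReal_mul (by positivity)]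
        congr 1
        -- The Gaussian integral over `β` contributes `s ^ (p / 2)`, which leaves the inverse gamma
        -- integrand of shape `ν / 2`.
        have : s ^ (-(ν / 2 + 1)) = s ^ (-(ν + (p + 1) + 1) / 2) * s ^ ((p : ℝ) / 2) := by
          rw [← Real.rpow_add hs]; congr 1; ring
        rw [this, Real.mul_rpow (by positivity) hs.le]
        ring
      rw [setLIntegral_congr_fun measurableSet_Ioi h4, lintegral_const_mul _ (by fun_prop),
        lintegral_rpow_mul_exp_neg_div (by positivity) (by positivity),
        ← ENNReal.ofReal_mul (by positivity), ← ENNReal.ofReal_mul (by positivity),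
        ← ENNReal.ofReal_mul hc0, invWishartKernel, if_pos hx, abs_of_pos hd]
      congr 1
      -- The Jacobian raises the exponent of the determinant by one. The new exponent belongs to
      -- size `p` with `ν - 1` degrees of freedom.
      have : (symMatrix x).det ^ (-(ν - 1 + p + 1) / 2) =
          (symMatrix x).det * (symMatrix x).det ^ (-(ν + (p + 1) + 1) / 2) := by
        conv_rhs => rw [← Real.rpow_one_add' hd.le (by
          have : (0 : ℝ) ≤ p := Nat.cast_nonneg p
          intro h; linarith)]
        congr 1; ring
      rw [this]
      simp only [hc, he]
      ring
    rw [lintegral_symCons hF]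
    simp_rw [inner]
    rw [lintegral_const_mul _ (measurable_invWishartKernel Φ (ν - 1)).ennreal_ofReal,
      ih hΦ (by push_cast at hν; linarith), ← ENNReal.ofReal_mul hc0]
    congr 1
    rw [multivariateGamma_succ, hdet, Real.mul_rpow hσ.le hΦd.le, hc,
      Real.mul_rpow two_pos.le Real.pi_pos.le, Real.div_rpow hσ.le two_pos.le,
      show -(ν - 1) / 2 = -ν / 2 + 1 / 2 by ring, Real.rpow_add hΦd,
      show (ν - 1) / 2 = ν / 2 - 1 / 2 by ring,
      show ν * ((p + 1 : ℕ) : ℝ) / 2 = (p : ℝ) / 2 + (ν - 1) * p / 2 + ν / 2 by push_cast; ring,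
      Real.rpow_add two_pos, Real.rpow_add two_pos, Real.rpow_neg hΦd.le,
      Real.rpow_neg two_pos.le, show -(ν / 2) = -ν / 2 by ring]
    field_simp

/-! ### The normal-inverse-Wishart prior -/

theorem measurable_normalPDF_prod {p : ℕ} :
    Measurable fun w : CategoryParam p × (Fin p → ℝ) => normalPDF w.1.1 w.1.cov w.2 := by
  have h1 : Measurable fun w : CategoryParam p × (Fin p → ℝ) => w.1.cov.det :=
    measurable_det_symMatrix.comp (measurable_snd.comp measurable_fst)
  have h2 : ∀ i j, Measurable fun w : CategoryParam p × (Fin p → ℝ) => w.1.cov⁻¹ i j :=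
    fun i j => (measurable_symMatrix_inv_apply i j).comp (measurable_snd.comp measurable_fst)
  have h3 : Measurable fun w : CategoryParam p × (Fin p → ℝ) =>
      (w.2 - w.1.1) ⬝ᵥ (w.1.cov⁻¹ *ᵥ (w.2 - w.1.1)) := by
    simp only [dotProduct, mulVec]
    have h4 : ∀ i, Measurable fun w : CategoryParam p × (Fin p → ℝ) => (w.2 - w.1.1) i := by
      intro i
      simp only [Pi.sub_apply]
      fun_prop
    exact Finset.measurable_sum _ fun i _ => (h4 i).mul
      (Finset.measurable_sum _ fun j _ => (h2 i j).mul (h4 j))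
  unfold normalPDF
  fun_prop

theorem measurable_prod_normalPDF {n p : ℕ} :
    Measurable fun w : CategoryParam p × (Fin n → Fin p → ℝ) =>
      ∏ i, ENNReal.ofReal (normalPDF w.1.1 w.1.cov (w.2 i)) :=
  Finset.measurable_prod _ fun i _ => (measurable_normalPDF_prod.comp
    (measurable_fst.prodMk ((measurable_pi_apply i).comp measurable_snd))).ennreal_ofReal

theorem measurable_normalPDF_param {p : ℕ} (y : Fin p → ℝ) :
    Measurable fun θ : CategoryParam p => normalPDF θ.1 θ.cov y := by
  have h : Measurable fun θ : CategoryParam p => (θ, y) := measurable_prodMk_right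
  have := measurable_normalPDF_prod.comp h
  simpa only [Function.comp_def] using this

theorem measurable_categoryLikelihood {n p : ℕ} (Y : Matrix (Fin n) (Fin p) ℝ) :
    Measurable (categoryLikelihood Y) := by
  have h := Finset.measurable_prod (Finset.univ : Finset (Fin n)) fun i _ =>
    (measurable_normalPDF_param (Y i)).ennreal_ofReal
  exact h

theorem invWishartPDF_eq_mul_kernel {p : ℕ} (Ψ : Matrix (Fin p) (Fin p) ℝ) (ν : ℝ)
    (S : Matrix (Fin p) (Fin p) ℝ) :
    invWishartPDF Ψ ν S = Ψ.det ^ (ν / 2) / ((2 : ℝ) ^ (ν * p / 2) * multivariateGamma p (ν / 2)) *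
      invWishartKernel Ψ ν S := by
  unfold invWishartPDF invWishartKernel
  split_ifs
  · rw [mul_assoc]
  · rw [mul_zero]

theorem measurable_invWishartPDF {p : ℕ} (Ψ : Matrix (Fin p) (Fin p) ℝ) (ν : ℝ) :
    Measurable fun x : Sym2 (Fin p) → ℝ => invWishartPDF Ψ ν (symMatrix x) := by
  simp only [invWishartPDF_eq_mul_kernel]
  exact (measurable_invWishartKernel Ψ ν).const_mul _

theorem measurable_niwPrior_density {p : ℕ} (η : Fin p → ℝ) (Ψ : Matrix (Fin p) (Fin p) ℝ)
    (ν : ℝ) : Measurable fun θ : CategoryParam p =>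
      ENNReal.ofReal (normalPDF η θ.cov θ.1) * ENNReal.ofReal (invWishartPDF Ψ ν θ.cov) := by
  refine Measurable.mul ?_ ((measurable_invWishartPDF Ψ ν).comp measurable_snd).ennreal_ofReal
  have h : Measurable fun θ : CategoryParam p => ((η, θ.2), θ.1) :=
    (measurable_const.prodMk measurable_snd).prodMk measurable_fst
  exact (measurable_normalPDF_prod.comp h).ennreal_ofReal

theorem lintegral_niwPrior {p : ℕ} (η : Fin p → ℝ) (Ψ : Matrix (Fin p) (Fin p) ℝ) (ν : ℝ)
    {f : CategoryParam p → ℝ≥0∞} (hf : Measurable f) :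
    ∫⁻ θ, f θ ∂niwPrior η Ψ ν =
      ∫⁻ x, ∫⁻ μ, ENNReal.ofReal (normalPDF η (symMatrix x) μ) *
        ENNReal.ofReal (invWishartPDF Ψ ν (symMatrix x)) * f (μ, x) := by
  have h := measurable_niwPrior_density η Ψ ν
  rw [niwPrior, lintegral_withDensity_eq_lintegral_mul _ h hf, Measure.volume_eq_prod,
    lintegral_prod_symm _ (h.mul hf).aemeasurable]
  rfl

/-- The inverse Wishart density vanishes elsewhere. The posterior inherits this by absolute
continuity. -/
theorem ae_niwPrior_posDef {p : ℕ} (η : Fin p → ℝ) (Ψ : Matrix (Fin p) (Fin p) ℝ) (ν : ℝ) :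
    ∀ᵐ θ ∂niwPrior η Ψ ν, θ.cov.PosDef := by
  rw [niwPrior, ae_withDensity_iff (measurable_niwPrior_density η Ψ ν)]
  refine Filter.Eventually.of_forall fun θ hθ => ?_
  by_contra h
  exact hθ (by simp [invWishartPDF, h])

/-! ### The scatter matrix -/

/-- The matrix `(Y - 1 ηᵀ)ᵀ (I - J / (n + 1)) (Y - 1 ηᵀ)` by which the data `Y` update the scale
matrix of the inverse Wishart distribution. -/
noncomputable def scatterMatrix {n p : ℕ} (η : Fin p → ℝ) (Y : Matrix (Fin n) (Fin p) ℝ) :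
    Matrix (Fin p) (Fin p) ℝ :=
  (Y - constRows n η)ᵀ * (1 - ((n : ℝ) + 1)⁻¹ • onesMatrix n n) * (Y - constRows n η)

theorem onesMatrix_mul_self (n : ℕ) : onesMatrix n n * onesMatrix n n = (n : ℝ) • onesMatrix n n := by
  ext i j
  simp [onesMatrix, Matrix.mul_apply]

theorem posDef_one_add_onesMatrix (n : ℕ) : (1 + onesMatrix n n).PosDef := by
  refine PosDef.one.add_posSemidef ?_
  have : onesMatrix n n = vecMulVec 1 (star 1) := by
    ext i j; simp [onesMatrix, vecMulVec_apply]
  rw [this]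
  exact posSemidef_vecMulVec_self_star _

theorem det_one_add_onesMatrix (n : ℕ) : (1 + onesMatrix n n).det = n + 1 := by
  have : onesMatrix n n = replicateCol Unit (1 : Fin n → ℝ) * replicateRow Unit (1 : Fin n → ℝ) := by
    ext i j; simp [onesMatrix, Matrix.mul_apply]
  rw [this, det_one_add_replicateCol_mul_replicateRow]
  simp [add_comm]

/-- A consequence of `J² = n J`. It identifies the middle factor of the scatter matrix with the
inverse of the row scale matrix of the matrix t law. -/
theorem inv_one_add_onesMatrix (n : ℕ) :
    (1 + onesMatrix n n)⁻¹ = 1 - ((n : ℝ) + 1)⁻¹ • onesMatrix n n := by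
  refine inv_eq_right_inv ?_
  have hn : (n : ℝ) + 1 ≠ 0 := by positivity
  simp only [Matrix.mul_sub, Matrix.add_mul, Matrix.mul_one, Matrix.one_mul, Matrix.mul_smul,
    onesMatrix_mul_self]
  ext i j
  simp only [Matrix.add_apply, Matrix.sub_apply, Matrix.smul_apply, smul_eq_mul]
  field_simp
  ring

theorem posSemidef_scatterMatrix {n p : ℕ} (η : Fin p → ℝ) (Y : Matrix (Fin n) (Fin p) ℝ) :
    (scatterMatrix η Y).PosSemidef := by
  have h := (posDef_one_add_onesMatrix n).inv.posSemidef.conjTranspose_mul_mul_same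
    (Y - constRows n η)
  rwa [inv_one_add_onesMatrix, conjTranspose_eq_transpose_of_trivial] at h

/-- In this form, traces against a matrix and the effect of an additional row can be read off. -/
theorem scatterMatrix_eq_sum {n p : ℕ} (η : Fin p → ℝ) (Y : Matrix (Fin n) (Fin p) ℝ) :
    scatterMatrix η Y = ∑ i, vecMulVec (Y i - η) (Y i - η) -
      ((n : ℝ) + 1)⁻¹ • vecMulVec (∑ i, (Y i - η)) (∑ i, (Y i - η)) := by
  have hX : ∀ i j, (Y - constRows n η) i j = Y i j - η j := fun i j => by
    simp [constRows]
  rw [scatterMatrix]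
  generalize Y - constRows n η = X at hX
  rw [Matrix.mul_sub, Matrix.sub_mul, Matrix.mul_one, Matrix.mul_smul, Matrix.smul_mul]
  ext j k
  simp only [Matrix.sub_apply, Matrix.smul_apply, smul_eq_mul, Matrix.sum_apply, vecMulVec_apply,
    Finset.sum_apply, Pi.sub_apply]
  congr 1
  · simp only [Matrix.mul_apply, transpose_apply, hX]
  · simp only [Matrix.mul_apply, transpose_apply, hX, onesMatrix, of_apply, mul_one,
      ← Finset.mul_sum]

theorem predictiveLocation_eq {n p : ℕ} (η : Fin p → ℝ) (Y : Matrix (Fin n) (Fin p) ℝ) :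
    predictiveLocation η Y = η + ((n : ℝ) + 1)⁻¹ • ∑ i, (Y i - η) := by
  have hn : (n : ℝ) + 1 ≠ 0 := by positivity
  ext j
  have h : (n : ℝ) * columnMean Y j = ∑ i, Y i j := by
    -- For `n = 0` both sides vanish, whatever value the mean of no observations takes.
    rcases n.eq_zero_or_pos with rfl | h0
    · simp
    · have : (n : ℝ) ≠ 0 := by positivity
      simp [columnMean, mulVec, dotProduct, mul_inv_cancel_left₀ this]
  simp only [predictiveLocation, Pi.smul_apply, Pi.add_apply, smul_eq_mul, h, Finset.sum_apply,
    Pi.sub_apply, Finset.sum_sub_distrib, Finset.sum_const, Finset.card_univ, Fintype.card_fin,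
    nsmul_eq_mul]
  field_simp
  ring

theorem trace_vecMulVec_self_mul {n : Type*} [Fintype n] (u : n → ℝ) (B : Matrix n n ℝ) :
    (vecMulVec u u * B).trace = u ⬝ᵥ (B *ᵥ u) := by
  rw [vecMulVec_mul, trace_vecMulVec, dotProduct_comm, ← dotProduct_mulVec]

/-- Completing the square in `m`. The term `m ⬝ᵥ B m` acts as one more observation, at the origin,
whence `n + 1`. -/
theorem sum_quadratic_sub {n p : ℕ} (x : Fin n → Fin p → ℝ) (m : Fin p → ℝ)
    {B : Matrix (Fin p) (Fin p) ℝ} (hB : Bᵀ = B) :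
    ∑ i, (x i - m) ⬝ᵥ (B *ᵥ (x i - m)) + m ⬝ᵥ (B *ᵥ m) =
      ((n : ℝ) + 1) * ((m - ((n : ℝ) + 1)⁻¹ • ∑ i, x i) ⬝ᵥ
        (B *ᵥ (m - ((n : ℝ) + 1)⁻¹ • ∑ i, x i))) +
      (∑ i, x i ⬝ᵥ (B *ᵥ x i) - ((n : ℝ) + 1)⁻¹ * ((∑ i, x i) ⬝ᵥ (B *ᵥ ∑ i, x i))) := by
  have hn : (n : ℝ) + 1 ≠ 0 := by positivity
  have hsym : ∀ u v : Fin p → ℝ, u ⬝ᵥ (B *ᵥ v) = v ⬝ᵥ (B *ᵥ u) := fun u v => by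
    rw [dotProduct_mulVec, ← mulVec_transpose, hB, dotProduct_comm]
  have h3 : ∑ i, (x i - m) ⬝ᵥ (B *ᵥ (x i - m)) =
      ∑ i, x i ⬝ᵥ (B *ᵥ x i) - 2 * ((∑ i, x i) ⬝ᵥ (B *ᵥ m)) + n * (m ⬝ᵥ (B *ᵥ m)) := by
    have : ∀ i, (x i - m) ⬝ᵥ (B *ᵥ (x i - m)) =
        x i ⬝ᵥ (B *ᵥ x i) - 2 * (x i ⬝ᵥ (B *ᵥ m)) + m ⬝ᵥ (B *ᵥ m) := by
      intro i
      rw [mulVec_sub, dotProduct_sub, sub_dotProduct, sub_dotProduct, hsym m (x i)]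
      ring
    simp only [this, Finset.sum_add_distrib, Finset.sum_sub_distrib, sum_dotProduct,
      Finset.mul_sum]
    simp
  rw [h3]
  generalize ∑ i, x i = X
  rw [mulVec_sub, dotProduct_sub, sub_dotProduct, sub_dotProduct, mulVec_smul,
    dotProduct_smul, smul_dotProduct, dotProduct_smul, smul_dotProduct, hsym m X]
  simp only [smul_eq_mul]
  field_simp
  ring

theorem sum_quadratic_eq {n p : ℕ} (η μ : Fin p → ℝ) (Y : Matrix (Fin n) (Fin p) ℝ)
    {B : Matrix (Fin p) (Fin p) ℝ} (hB : Bᵀ = B) :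
    ∑ i, (Y i - μ) ⬝ᵥ (B *ᵥ (Y i - μ)) + (μ - η) ⬝ᵥ (B *ᵥ (μ - η)) =
      ((n : ℝ) + 1) * ((μ - predictiveLocation η Y) ⬝ᵥ (B *ᵥ (μ - predictiveLocation η Y))) +
        (scatterMatrix η Y * B).trace := by
  have h1 : ∀ i, Y i - μ = (Y i - η) - (μ - η) := fun i => (sub_sub_sub_cancel_right _ _ _).symm
  have h4 : (scatterMatrix η Y * B).trace = ∑ i, (Y i - η) ⬝ᵥ (B *ᵥ (Y i - η)) -
      ((n : ℝ) + 1)⁻¹ * ((∑ i, (Y i - η)) ⬝ᵥ (B *ᵥ ∑ i, (Y i - η))) := by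
    rw [scatterMatrix_eq_sum, Matrix.sub_mul, trace_sub, Finset.sum_mul, trace_sum,
      Matrix.smul_mul, trace_smul, trace_vecMulVec_self_mul, smul_eq_mul]
    simp only [trace_vecMulVec_self_mul]
  simp only [h1]
  rw [h4, predictiveLocation_eq, sub_add_eq_sub_sub]
  exact sum_quadratic_sub (fun i => Y i - η) (μ - η) hB

/-! ### The marginal likelihood -/

/-- Conjugacy in `μ`: after completing the square, `μ` occurs only in a normal density around the
predictive location. -/
theorem prod_normalPDF_mul_normalPDF {n p : ℕ} (η μ : Fin p → ℝ) (Y : Matrix (Fin n) (Fin p) ℝ)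
    {S : Matrix (Fin p) (Fin p) ℝ} (hS : S.PosDef) :
    (∏ i, normalPDF μ S (Y i)) * normalPDF η S μ =
      ((2 * Real.pi) ^ (-((n : ℝ) * p) / 2) * ((n : ℝ) + 1) ^ (-(p : ℝ) / 2)) *
        (S.det ^ (-(n : ℝ) / 2) * Real.exp (-(scatterMatrix η Y * S⁻¹).trace / 2)) *
        normalPDF (predictiveLocation η Y) (((n : ℝ) + 1)⁻¹ • S) μ := by
  have hn : (0 : ℝ) < (n : ℝ) + 1 := by positivity
  have hd := hS.det_pos
  have hSt : (S⁻¹)ᵀ = S⁻¹ := by simpa using hS.inv.isHermitian.eq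
  have hinv : (((n : ℝ) + 1)⁻¹ • S)⁻¹ = ((n : ℝ) + 1) • S⁻¹ := by
    refine inv_eq_left_inv ?_
    rw [Matrix.smul_mul, Matrix.mul_smul, nonsing_inv_mul _ hd.ne'.isUnit, smul_smul,
      mul_inv_cancel₀ hn.ne', one_smul]
  have hdet : (((n : ℝ) + 1)⁻¹ • S).det ^ (-(1 / 2) : ℝ) =
      ((n : ℝ) + 1) ^ ((p : ℝ) / 2) * S.det ^ (-(1 / 2) : ℝ) := by
    rw [det_smul, Fintype.card_fin, Real.mul_rpow (by positivity) hd.le, ← Real.rpow_natCast,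
      ← Real.rpow_mul (by positivity), Real.inv_rpow hn.le, ← Real.rpow_neg hn.le]
    congr 2; ring
  have hexp : (∏ i, Real.exp (-((Y i - μ) ⬝ᵥ (S⁻¹ *ᵥ (Y i - μ))) / 2)) *
      Real.exp (-((μ - η) ⬝ᵥ (S⁻¹ *ᵥ (μ - η))) / 2) =
      Real.exp (-(scatterMatrix η Y * S⁻¹).trace / 2) *
      Real.exp (-((μ - predictiveLocation η Y) ⬝ᵥ ((((n : ℝ) + 1) • S⁻¹) *ᵥ
        (μ - predictiveLocation η Y))) / 2) := by
    rw [← Real.exp_sum, ← Real.exp_add, ← Real.exp_add, ← Finset.sum_div, Finset.sum_neg_distrib,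
      smul_mulVec, dotProduct_smul, smul_eq_mul]
    congr 1
    have := sum_quadratic_eq η μ Y hSt
    linarith
  have hpi : ((2 * Real.pi) ^ (-(p : ℝ) / 2)) ^ n = (2 * Real.pi) ^ (-((n : ℝ) * p) / 2) := by
    rw [← Real.rpow_natCast, ← Real.rpow_mul (by positivity)]
    congr 1; ring
  have hSn : (S.det ^ (-(1 / 2) : ℝ)) ^ n = S.det ^ (-(n : ℝ) / 2) := by
    rw [← Real.rpow_natCast, ← Real.rpow_mul hd.le]
    congr 1; ring
  -- The normal density with covariance `S / (n + 1)` brings in the power `(n + 1) ^ (p / 2)`, which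
  -- the constant in front compensates.
  have hcancel : ((n : ℝ) + 1) ^ (-(p : ℝ) / 2) * ((n : ℝ) + 1) ^ ((p : ℝ) / 2) = 1 := by
    rw [← Real.rpow_add hn, neg_div, neg_add_cancel, Real.rpow_zero]
  simp only [normalPDF, Finset.prod_mul_distrib, Finset.prod_const, Finset.card_univ,
    Fintype.card_fin, hinv, hdet, hpi, hSn]
  calc _ = (2 * Real.pi) ^ (-((n : ℝ) * p) / 2) * S.det ^ (-(n : ℝ) / 2) *
        ((2 * Real.pi) ^ (-(p : ℝ) / 2) * S.det ^ (-(1 / 2) : ℝ)) *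
        ((∏ i, Real.exp (-((Y i - μ) ⬝ᵥ (S⁻¹ *ᵥ (Y i - μ))) / 2)) *
          Real.exp (-((μ - η) ⬝ᵥ (S⁻¹ *ᵥ (μ - η))) / 2)) := by ring
    _ = (2 * Real.pi) ^ (-((n : ℝ) * p) / 2) * S.det ^ (-(n : ℝ) / 2) *
        ((2 * Real.pi) ^ (-(p : ℝ) / 2) * S.det ^ (-(1 / 2) : ℝ)) *
        (((n : ℝ) + 1) ^ (-(p : ℝ) / 2) * ((n : ℝ) + 1) ^ ((p : ℝ) / 2)) *
        (Real.exp (-(scatterMatrix η Y * S⁻¹).trace / 2) *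
      Real.exp (-((μ - predictiveLocation η Y) ⬝ᵥ ((((n : ℝ) + 1) • S⁻¹) *ᵥ
        (μ - predictiveLocation η Y))) / 2)) := by rw [hexp, hcancel, mul_one]
    _ = _ := by ring

theorem invWishartKernel_mul {p : ℕ} (Ψ A S : Matrix (Fin p) (Fin p) ℝ) (ν c : ℝ) :
    invWishartKernel Ψ ν S * (S.det ^ (-c / 2) * Real.exp (-(A * S⁻¹).trace / 2)) =
      invWishartKernel (Ψ + A) (ν + c) S := by
  unfold invWishartKernel
  split_ifs with hS
  · have h1 : S.det ^ (-(ν + c + p + 1) / 2) = S.det ^ (-(ν + p + 1) / 2) * S.det ^ (-c / 2) := by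
      rw [← Real.rpow_add hS.det_pos]; congr 1; ring
    have h2 : Real.exp (-((Ψ + A) * S⁻¹).trace / 2) =
        Real.exp (-(Ψ * S⁻¹).trace / 2) * Real.exp (-(A * S⁻¹).trace / 2) := by
      rw [← Real.exp_add, Matrix.add_mul, trace_add]; congr 1; ring
    rw [h1, h2]
    ring
  · rw [zero_mul]

/-- The integral over `μ` is one. The integral over `Σ` is an inverse Wishart normalizing constant
with parameters `Ψ + A` and `ν + n`, where `A` is the scatter matrix, divided by the constant of the
prior. -/
theorem marginalLikelihood_eq {n p : ℕ} (η : Fin p → ℝ) {Ψ : Matrix (Fin p) (Fin p) ℝ}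
    (hΨ : Ψ.PosDef) {ν : ℝ} (hν : (p : ℝ) - 1 < ν) (Y : Matrix (Fin n) (Fin p) ℝ) :
    marginalLikelihood η Ψ ν Y = ENNReal.ofReal
      (Real.pi ^ (-((n : ℝ) * p) / 2) * ((n : ℝ) + 1) ^ (-(p : ℝ) / 2) *
        (multivariateGamma p ((ν + n) / 2) / multivariateGamma p (ν / 2)) *
        (Ψ.det ^ (ν / 2) * (Ψ + scatterMatrix η Y).det ^ (-(ν + n) / 2))) := by
  have hn : (0 : ℝ) < (n : ℝ) + 1 := by positivity
  have hΨA : (Ψ + scatterMatrix η Y).PosDef := hΨ.add_posSemidef (posSemidef_scatterMatrix η Y)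
  have hd := hΨ.det_pos
  have hΓ : 0 < multivariateGamma p (ν / 2) := multivariateGamma_pos (by linarith)
  have hn0 : (0 : ℝ) ≤ n := Nat.cast_nonneg n
  set k : ℝ := (2 * Real.pi) ^ (-((n : ℝ) * p) / 2) * ((n : ℝ) + 1) ^ (-(p : ℝ) / 2) with hk
  set c : ℝ := Ψ.det ^ (ν / 2) / ((2 : ℝ) ^ (ν * p / 2) * multivariateGamma p (ν / 2)) with hc
  have hk0 : 0 ≤ k := by positivity
  have hc0 : 0 ≤ c := by positivity
  have inner : ∀ x : Sym2 (Fin p) → ℝ, ∫⁻ μ, ENNReal.ofReal (normalPDF η (symMatrix x) μ) *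
        ENNReal.ofReal (invWishartPDF Ψ ν (symMatrix x)) * categoryLikelihood Y (μ, x) =
      ENNReal.ofReal (c * k) *
        ENNReal.ofReal (invWishartKernel (Ψ + scatterMatrix η Y) (ν + n) (symMatrix x)) := by
    intro x
    by_cases hx : (symMatrix x).PosDef
    swap
    · simp [invWishartPDF, invWishartKernel, hx]
    have hdx := hx.det_pos
    have hker : 0 ≤ invWishartKernel Ψ ν (symMatrix x) := by
      rw [invWishartKernel, if_pos hx]; positivity
    have h1 : ∀ μ, ENNReal.ofReal (normalPDF η (symMatrix x) μ) *
        ENNReal.ofReal (invWishartPDF Ψ ν (symMatrix x)) * categoryLikelihood Y (μ, x) =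
        ENNReal.ofReal (c * k) *
        ENNReal.ofReal (invWishartKernel (Ψ + scatterMatrix η Y) (ν + n) (symMatrix x)) *
        ENNReal.ofReal (normalPDF (predictiveLocation η Y) (((n : ℝ) + 1)⁻¹ • symMatrix x) μ) := by
      intro μ
      have hnn := fun (μ y : Fin p → ℝ) => normalPDF_nonneg μ hdx.le y
      have h0 : categoryLikelihood Y (μ, x) =
          ENNReal.ofReal (∏ i, normalPDF μ (symMatrix x) (Y i)) :=
        (ENNReal.ofReal_prod_of_nonneg fun i _ => hnn _ _).symm
      rw [h0, ← ENNReal.ofReal_mul (hnn _ _),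
        invWishartPDF_eq_mul_kernel, ← hc, ← invWishartKernel_mul,
        ← ENNReal.ofReal_mul (mul_nonneg (hnn _ _) (mul_nonneg hc0 hker)),
        ← ENNReal.ofReal_mul (by positivity), ← ENNReal.ofReal_mul (by positivity)]
      congr 1
      have h2 := prod_normalPDF_mul_normalPDF η μ Y hx
      calc _ = c * invWishartKernel Ψ ν (symMatrix x) *
            ((∏ i, normalPDF μ (symMatrix x) (Y i)) * normalPDF η (symMatrix x) μ) := by ring
        _ = _ := by rw [h2]; ring
    simp_rw [h1]
    rw [lintegral_const_mul _ (continuous_normalPDF _ _).measurable.ennreal_ofReal,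
      lintegral_normalPDF _ (hx.smul (by positivity)), mul_one]
  rw [marginalLikelihood, lintegral_niwPrior _ _ _ (measurable_categoryLikelihood Y)]
  simp_rw [inner]
  rw [lintegral_const_mul _ (measurable_invWishartKernel _ _).ennreal_ofReal,
    lintegral_invWishartKernel hΨA (by linarith), ← ENNReal.ofReal_mul (by positivity)]
  congr 1
  -- The powers of two cancel, because `(ν + n) p / 2` splits into `ν p / 2` and `n p / 2`.
  rw [hc, hk, Real.mul_rpow two_pos.le Real.pi_pos.le,
    show (ν + n) * p / 2 = ν * p / 2 + (n * p) / 2 by ring, Real.rpow_add two_pos,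
    neg_div 2 ((n : ℝ) * p), Real.rpow_neg two_pos.le]
  field_simp

theorem marginalLikelihood_eq_matrixTPDF {n p : ℕ} (η : Fin p → ℝ) {Ψ : Matrix (Fin p) (Fin p) ℝ}
    (hΨ : Ψ.PosDef) {ν : ℝ} (hν : (p : ℝ) - 1 < ν) (Y : Matrix (Fin n) (Fin p) ℝ) :
    marginalLikelihood η Ψ ν Y = ENNReal.ofReal
      (matrixTPDF (ν + 1 - p) (constRows n η) (1 + onesMatrix n n) Ψ Y) := by
  have hd := hΨ.det_pos
  have hΨA : (Ψ + scatterMatrix η Y).PosDef := hΨ.add_posSemidef (posSemidef_scatterMatrix η Y)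
  have hdet : (1 + (1 + onesMatrix n n)⁻¹ * (Y - constRows n η) * Ψ⁻¹ *
      (Y - constRows n η)ᵀ).det = (Ψ + scatterMatrix η Y).det / Ψ.det := by
    -- Sylvester's identity replaces the `n × n` determinant by a `p × p` one, which multiplication
    -- by `det Ψ` turns into `det (Ψ + A)`, with `A` the scatter matrix.
    rw [det_one_add_mul_comm, inv_one_add_onesMatrix, eq_div_iff hd.ne', ← det_mul, add_mul,
      Matrix.one_mul, scatterMatrix]
    congr 2
    simp only [Matrix.mul_assoc]
    rw [nonsing_inv_mul _ hd.ne'.isUnit, Matrix.mul_one]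
  rw [marginalLikelihood_eq η hΨ hν, matrixTPDF, det_one_add_onesMatrix, hdet,
    show ((n : ℝ) + (ν + 1 - p) + p - 1) / 2 = (ν + n) / 2 by ring,
    show (ν + 1 - p + p - 1) / 2 = ν / 2 by ring,
    show -((n : ℝ) + (ν + 1 - p) + p - 1) / 2 = -(ν + n) / 2 by ring,
    Real.div_rpow hΨA.det_pos.le hd.le, neg_div 2 ((n : ℝ) * p), Real.rpow_neg Real.pi_pos.le]
  congr 1
  have : Ψ.det ^ (ν / 2) = Ψ.det ^ (-(n : ℝ) / 2) / Ψ.det ^ (-(ν + n) / 2) := by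
    rw [← Real.rpow_sub hd]; congr 1; ring
  rw [this]
  field_simp

/-! ### Posterior distributions -/

theorem lintegral_posteriorLaw {Θ : Type*} [MeasurableSpace Θ] (prior : Measure Θ) {L : Θ → ℝ≥0∞}
    (hL : Measurable L) {f : Θ → ℝ≥0∞} (hf : Measurable f) :
    ∫⁻ θ, f θ ∂posteriorLaw prior L = (∫⁻ θ, L θ ∂prior)⁻¹ * ∫⁻ θ, L θ * f θ ∂prior := by
  rw [posteriorLaw, lintegral_smul_measure, lintegral_withDensity_eq_lintegral_mul _ hL hf,
    smul_eq_mul]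
  rfl

theorem isProbabilityMeasure_posteriorLaw {Θ : Type*} [MeasurableSpace Θ] {prior : Measure Θ}
    {L : Θ → ℝ≥0∞} (h0 : ∫⁻ θ, L θ ∂prior ≠ 0) (htop : ∫⁻ θ, L θ ∂prior ≠ ∞) :
    IsProbabilityMeasure (posteriorLaw prior L) := by
  refine ⟨?_⟩
  rw [posteriorLaw, Measure.smul_apply, withDensity_apply _ .univ, Measure.restrict_univ,
    smul_eq_mul, ENNReal.inv_mul_cancel h0 htop]

theorem posteriorLaw_absolutelyContinuous {Θ : Type*} [MeasurableSpace Θ] (prior : Measure Θ)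
    (L : Θ → ℝ≥0∞) : posteriorLaw prior L ≪ prior :=
  (withDensity_absolutelyContinuous prior L).smul_left _

section NormalInverseWishart
variable {n p : ℕ} (η : Fin p → ℝ) {Ψ : Matrix (Fin p) (Fin p) ℝ} {ν : ℝ}

theorem marginalLikelihood_ne_zero (hΨ : Ψ.PosDef) (hν : (p : ℝ) - 1 < ν)
    (Y : Matrix (Fin n) (Fin p) ℝ) : marginalLikelihood η Ψ ν Y ≠ 0 := by
  have hd := hΨ.det_pos
  have hdA := (hΨ.add_posSemidef (posSemidef_scatterMatrix η Y)).det_pos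
  have hn : (0 : ℝ) ≤ n := Nat.cast_nonneg n
  have h1 : 0 < multivariateGamma p (ν / 2) := multivariateGamma_pos (by linarith)
  have h2 : 0 < multivariateGamma p ((ν + n) / 2) := multivariateGamma_pos (by linarith)
  rw [marginalLikelihood_eq η hΨ hν]
  exact (ENNReal.ofReal_pos.2 (by positivity)).ne'

theorem marginalLikelihood_ne_top (hΨ : Ψ.PosDef) (hν : (p : ℝ) - 1 < ν)
    (Y : Matrix (Fin n) (Fin p) ℝ) : marginalLikelihood η Ψ ν Y ≠ ∞ := by
  rw [marginalLikelihood_eq η hΨ hν]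
  exact ENNReal.ofReal_ne_top

/-- The total mass is the marginal likelihood of an empty data set. -/
theorem isProbabilityMeasure_niwPrior (hΨ : Ψ.PosDef) (hν : (p : ℝ) - 1 < ν) :
    IsProbabilityMeasure (niwPrior η Ψ ν) := by
  refine ⟨?_⟩
  have h := marginalLikelihood_eq η hΨ hν (0 : Matrix (Fin 0) (Fin p) ℝ)
  have hs : scatterMatrix η (0 : Matrix (Fin 0) (Fin p) ℝ) = 0 := by
    simp [scatterMatrix_eq_sum]
  have hΓ : 0 < multivariateGamma p (ν / 2) := multivariateGamma_pos (by linarith)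
  have hpow : Ψ.det ^ (ν / 2) * Ψ.det ^ (-ν / 2) = 1 := by
    rw [← Real.rpow_add hΨ.det_pos, neg_div, add_neg_cancel, Real.rpow_zero]
  rw [hs] at h
  simpa [marginalLikelihood, categoryLikelihood, hpow, div_self hΓ.ne'] using h

theorem isProbabilityMeasure_niwPosterior (hΨ : Ψ.PosDef) (hν : (p : ℝ) - 1 < ν)
    (Y : Matrix (Fin n) (Fin p) ℝ) : IsProbabilityMeasure (niwPosterior η Ψ ν Y) :=
  isProbabilityMeasure_posteriorLaw (marginalLikelihood_ne_zero η hΨ hν Y)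
    (marginalLikelihood_ne_top η hΨ hν Y)

theorem ae_niwPosterior_posDef (Y : Matrix (Fin n) (Fin p) ℝ) :
    ∀ᵐ θ ∂niwPosterior η Ψ ν Y, θ.cov.PosDef :=
  (posteriorLaw_absolutelyContinuous _ _).ae_le (ae_niwPrior_posDef η Ψ ν)

/-! ### The marginal law of the data -/

theorem pi_normalLaw_eq_withDensity {n p : ℕ} (μ : Fin p → ℝ) {S : Matrix (Fin p) (Fin p) ℝ}
    (hS : S.PosDef) :
    (Measure.pi fun _ : Fin n => normalLaw μ S) =
      volume.withDensity fun Y : Fin n → Fin p → ℝ =>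
        ∏ i, ENNReal.ofReal (normalPDF μ S (Y i)) := by
  have h := normalLaw_eq_withDensity μ hS
  have hσ : SigmaFinite ((volume : Measure (Fin p → ℝ)).withDensity
      fun y => ENNReal.ofReal (normalPDF μ S y)) := by
    rw [← h]; infer_instance
  rw [h]
  exact pi_withDensity (fun _ : Fin n => (volume : Measure (Fin p → ℝ))) _
    (fun _ => (continuous_normalPDF μ S).measurable.ennreal_ofReal) fun _ => hσ

theorem marginalDataLaw_eq_matrixTLaw (hΨ : Ψ.PosDef) (hν : (p : ℝ) - 1 < ν) :
    marginalDataLaw n η Ψ ν =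
      matrixTLaw (ν + 1 - p) (constRows n η) (1 + onesMatrix n n) Ψ := by
  have := isProbabilityMeasure_niwPrior η hΨ hν
  have hae : ∀ᵐ θ ∂niwPrior η Ψ ν, (Measure.pi fun _ : Fin n => normalLaw θ.1 θ.cov) =
      volume.withDensity fun Y : Fin n → Fin p → ℝ =>
        ∏ i, ENNReal.ofReal (normalPDF θ.1 θ.cov (Y i)) := by
    filter_upwards [ae_niwPrior_posDef η Ψ ν] with θ hθ
    exact pi_normalLaw_eq_withDensity θ.1 hθ
  rw [marginalDataLaw, bind_withDensity_of_ae_eq measurable_prod_normalPDF hae, matrixTLaw]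
  congr 1
  funext Y
  exact marginalLikelihood_eq_matrixTPDF η hΨ hν (Matrix.of Y)

/-! ### The predictive law -/

theorem aemeasurable_normalLaw_niwPosterior (Y : Matrix (Fin n) (Fin p) ℝ) :
    AEMeasurable (fun θ => normalLaw θ.1 θ.cov) (niwPosterior η Ψ ν Y) := by
  refine aemeasurable_of_ae_eq_withDensity (ρ := volume)
    (f := fun θ y => ENNReal.ofReal (normalPDF θ.1 θ.cov y))
    measurable_normalPDF_prod.ennreal_ofReal ?_
  filter_upwards [ae_niwPosterior_posDef η Y] with θ hθ
  exact normalLaw_eq_withDensity θ.1 hθ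

/-- The normal density at `y` times the likelihood of `Y` is the likelihood of `Y` with `y` put in
front. Its prior integral, normalized, is therefore a ratio of marginal likelihoods. -/
theorem predictiveLaw_eq_withDensity (hΨ : Ψ.PosDef) (hν : (p : ℝ) - 1 < ν)
    (Y : Matrix (Fin n) (Fin p) ℝ) :
    predictiveLaw η Ψ ν Y = volume.withDensity fun y =>
      (marginalLikelihood η Ψ ν Y)⁻¹ *
        marginalLikelihood η Ψ ν (Matrix.of (Fin.cons y Y : Fin (n + 1) → Fin p → ℝ)) := by
  have := isProbabilityMeasure_niwPosterior η hΨ hν Y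
  have hae : ∀ᵐ θ ∂niwPosterior η Ψ ν Y, normalLaw θ.1 θ.cov =
      volume.withDensity fun y => ENNReal.ofReal (normalPDF θ.1 θ.cov y) := by
    filter_upwards [ae_niwPosterior_posDef η Y] with θ hθ
    exact normalLaw_eq_withDensity θ.1 hθ
  rw [predictiveLaw, bind_withDensity_of_ae_eq measurable_normalPDF_prod.ennreal_ofReal hae]
  congr 1
  funext y
  rw [niwPosterior, lintegral_posteriorLaw _ (measurable_categoryLikelihood Y)
    (measurable_normalPDF_param y).ennreal_ofReal]
  refine congrArg _ (lintegral_congr fun θ => ?_)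
  simp only [categoryLikelihood, Fin.prod_univ_succ]
  rw [mul_comm]
  rfl

/-- With `u = y - η` and `X` the sum of the centred rows, the claim is that `u uᵀ - (X + u)(X +
u)ᵀ/(n+2) + X Xᵀ/(n+1)` is `(n+1)/(n+2)` times the square of `u - X/(n+1)`. -/
theorem scatterMatrix_cons (Y : Matrix (Fin n) (Fin p) ℝ) (y : Fin p → ℝ) :
    scatterMatrix η (Matrix.of (Fin.cons y Y : Fin (n + 1) → Fin p → ℝ)) =
      scatterMatrix η Y + (((n : ℝ) + 1) / ((n : ℝ) + 2)) •
        vecMulVec (y - predictiveLocation η Y) (y - predictiveLocation η Y) := by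
  have h1 : ∀ i, (Matrix.of (Fin.cons y Y : Fin (n + 1) → Fin p → ℝ)) i.succ = Y i := fun i => rfl
  have h2 : (Matrix.of (Fin.cons y Y : Fin (n + 1) → Fin p → ℝ)) 0 = y := rfl
  rw [scatterMatrix_eq_sum, scatterMatrix_eq_sum, predictiveLocation_eq, Fin.sum_univ_succ,
    Fin.sum_univ_succ]
  simp only [h1, h2]
  rw [sub_add_eq_sub_sub]
  generalize ∑ i, (Y i - η) = X
  generalize y - η = u
  ext j k
  have hn : (n : ℝ) + 1 ≠ 0 := by positivity
  have hn2 : (n : ℝ) + 2 ≠ 0 := by positivity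
  have hn3 : (n : ℝ) + 1 + 1 ≠ 0 := by positivity
  simp only [Matrix.add_apply, Matrix.sub_apply, Matrix.smul_apply, smul_eq_mul, vecMulVec_apply,
    Pi.add_apply, Pi.sub_apply, Pi.smul_apply]
  push_cast
  field_simp
  ring

theorem det_add_smul_vecMulVec {B : Matrix (Fin p) (Fin p) ℝ} (hB : B.det ≠ 0) (c : ℝ)
    (v : Fin p → ℝ) :
    (B + c • vecMulVec v v).det = B.det * (1 + c * (v ⬝ᵥ (B⁻¹ *ᵥ v))) := by
  have h : c • vecMulVec v v = replicateCol Unit (c • v) * replicateRow Unit v := by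
    ext i j; simp [vecMulVec_apply, Matrix.mul_apply, mul_assoc]
  rw [h, det_add_replicateCol_mul_replicateRow hB.isUnit]
  congr 1
  rw [det_unique, Matrix.mul_assoc, ← replicateCol_mulVec, replicateRow_mul_replicateCol, mulVec_smul]
  simp

/-- Raising the argument by one half shifts the factors of the product by one place, so only the end
factors differ. -/
theorem multivariateGamma_add_half (p : ℕ) (a : ℝ) :
    multivariateGamma p (a + 1 / 2) * Real.Gamma (a + 1 / 2 - p / 2) =
      multivariateGamma p a * Real.Gamma (a + 1 / 2) := by
  have h := (Fin.prod_univ_castSucc fun j : Fin (p + 1) =>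
    Real.Gamma (a + 1 / 2 - (j : ℝ) / 2)).symm.trans (Fin.prod_univ_succ _)
  have h2 : ∀ j : Fin p, a + 1 / 2 - ((j.succ : ℕ) : ℝ) / 2 = a - (j : ℝ) / 2 := fun j => by
    push_cast [Fin.val_succ]; ring
  simp only [h2, Fin.val_castSucc, Fin.val_last, Fin.val_zero, Nat.cast_zero, zero_div,
    sub_zero] at h
  rw [multivariateGamma, multivariateGamma, mul_assoc, h]
  ring

theorem posDef_predictiveScale (hΨ : Ψ.PosDef) (hν : (p : ℝ) - 1 < ν)
    (Y : Matrix (Fin n) (Fin p) ℝ) : (predictiveScale η Ψ ν Y).PosDef := by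
  have hn : (0 : ℝ) ≤ n := Nat.cast_nonneg n
  have : 0 < (n : ℝ) + ν + 1 - p := by linarith
  exact (hΨ.add_posSemidef (posSemidef_scatterMatrix η Y)).smul (by positivity)

theorem marginalLikelihood_cons_div (hΨ : Ψ.PosDef) (hν : (p : ℝ) - 1 < ν)
    (Y : Matrix (Fin n) (Fin p) ℝ) (y : Fin p → ℝ) :
    (marginalLikelihood η Ψ ν Y)⁻¹ *
        marginalLikelihood η Ψ ν (Matrix.of (Fin.cons y Y : Fin (n + 1) → Fin p → ℝ)) =
      ENNReal.ofReal (multivariateTPDF (n + ν + 1 - p) (predictiveLocation η Y)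
        (predictiveScale η Ψ ν Y) y) := by
  have hn : (0 : ℝ) ≤ n := Nat.cast_nonneg n
  have hn1 : (0 : ℝ) < (n : ℝ) + 1 := by positivity
  have hn2 : (0 : ℝ) < (n : ℝ) + 2 := by positivity
  have hd := hΨ.det_pos
  have hB := hΨ.add_posSemidef (posSemidef_scatterMatrix η Y)
  have hBd := hB.det_pos
  have h1 : 0 < multivariateGamma p (ν / 2) := multivariateGamma_pos (by linarith)
  have h2 : 0 < multivariateGamma p ((ν + n) / 2) := multivariateGamma_pos (by linarith)
  obtain ⟨m, hm⟩ : ∃ m : ℝ, m = n + ν + 1 - p := ⟨_, rfl⟩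
  have hm0 : 0 < m := by linarith
  have hΓm : 0 < Real.Gamma (m / 2) := Real.Gamma_pos_of_pos (by positivity)
  have hscale : predictiveScale η Ψ ν Y =
      (((n : ℝ) + 2) / (((n : ℝ) + 1) * m)) • (Ψ + scatterMatrix η Y) := by
    rw [hm]; rfl
  rw [marginalLikelihood_eq η hΨ hν, marginalLikelihood_eq η hΨ hν, scatterMatrix_cons,
    ← add_assoc, det_add_smul_vecMulVec hBd.ne', multivariateTPDF, ← hm, hscale]
  set B := Ψ + scatterMatrix η Y with hBdef
  set v := y - predictiveLocation η Y with hv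
  have hq : 0 ≤ v ⬝ᵥ (B⁻¹ *ᵥ v) := by
    simpa using hB.inv.posSemidef.dotProduct_mulVec_nonneg v
  set q := v ⬝ᵥ (B⁻¹ *ᵥ v) with hqdef
  have hinv : ((((n : ℝ) + 2) / (((n : ℝ) + 1) * m)) • B)⁻¹ =
      (((n : ℝ) + 1) * m / ((n : ℝ) + 2)) • B⁻¹ := by
    refine inv_eq_left_inv ?_
    rw [Matrix.smul_mul, Matrix.mul_smul, nonsing_inv_mul _ hBd.ne'.isUnit, smul_smul]
    have : ((n : ℝ) + 1) * m / ((n : ℝ) + 2) * (((n : ℝ) + 2) / (((n : ℝ) + 1) * m)) = 1 := by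
      field_simp
    rw [this, one_smul]
  -- The factor `(n + 2) / ((n + 1) m)` in the predictive scale is what makes the t quadratic form
  -- agree with the rank one update of the scatter matrix.
  have hquad : 1 + 1 / m * (v ⬝ᵥ ((((n : ℝ) + 2) / (((n : ℝ) + 1) * m)) • B)⁻¹ *ᵥ v) =
      1 + ((n : ℝ) + 1) / ((n : ℝ) + 2) * q := by
    rw [hinv, smul_mulVec, dotProduct_smul, smul_eq_mul, ← hqdef]
    field_simp
  have hdet : ((((n : ℝ) + 2) / (((n : ℝ) + 1) * m)) • B).det ^ (-(1 / 2) : ℝ) =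
      ((n : ℝ) + 2) ^ (-(p : ℝ) / 2) * (((n : ℝ) + 1) ^ (-(p : ℝ) / 2))⁻¹ * m ^ ((p : ℝ) / 2) *
        B.det ^ (-(1 / 2) : ℝ) := by
    rw [det_smul, Fintype.card_fin, Real.mul_rpow (by positivity) hBd.le, ← Real.rpow_natCast,
      ← Real.rpow_mul (by positivity), show (p : ℝ) * -(1 / 2) = -(p : ℝ) / 2 by ring,
      Real.div_rpow hn2.le (by positivity), Real.mul_rpow hn1.le hm0.le, neg_div 2 (p : ℝ),
      Real.rpow_neg hm0.le]
    field_simp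
  -- The multivariate gamma functions at `(ν + n + 1) / 2` and `(ν + n) / 2` have as quotient the
  -- ordinary gamma quotient of the t density, since `(ν + n + 1 - p) / 2 = m / 2`.
  have hΓ := multivariateGamma_add_half p ((ν + n) / 2)
  rw [show (ν + n) / 2 + 1 / 2 - (p : ℝ) / 2 = m / 2 by rw [hm]; ring,
    show (ν + n) / 2 + 1 / 2 = (ν + (n + 1 : ℕ)) / 2 by push_cast; ring] at hΓ
  have hΓ' : multivariateGamma p ((ν + (n + 1 : ℕ)) / 2) / multivariateGamma p ((ν + n) / 2) =
      Real.Gamma ((m + p) / 2) / Real.Gamma (m / 2) := by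
    rw [div_eq_div_iff h2.ne' hΓm.ne', hΓ, mul_comm]
    congr 2
    rw [hm]; push_cast; ring
  have hdetpow : B.det ^ (-(ν + (n + 1 : ℕ)) / 2) =
      B.det ^ (-(ν + n) / 2) * B.det ^ (-(1 / 2) : ℝ) := by
    rw [← Real.rpow_add hBd]; congr 1; push_cast; ring
  have hpipow : Real.pi ^ (-(((n + 1 : ℕ) : ℝ) * p) / 2) =
      Real.pi ^ (-((n : ℝ) * p) / 2) * (Real.pi ^ ((p : ℝ) / 2))⁻¹ := by
    rw [← Real.rpow_neg Real.pi_pos.le, ← Real.rpow_add Real.pi_pos]; congr 1; push_cast; ring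
  rw [hquad, hdet, Real.mul_rpow hBd.le (by positivity), hdetpow, hpipow,
    ← ENNReal.ofReal_inv_of_pos (by positivity), ← ENNReal.ofReal_mul (by positivity),
    Real.mul_rpow Real.pi_pos.le hm0.le,
    show -(m + p) / 2 = -(ν + (n + 1 : ℕ)) / 2 by rw [hm]; push_cast; ring,
    show (((n + 1 : ℕ) : ℝ) + 1) = (n : ℝ) + 2 by push_cast; ring]
  congr 1
  rw [show Real.Gamma ((m + p) / 2) =
    multivariateGamma p ((ν + (n + 1 : ℕ)) / 2) / multivariateGamma p ((ν + n) / 2) *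
      Real.Gamma (m / 2) by rw [hΓ']; field_simp]
  field_simp

theorem predictiveLaw_eq_multivariateTLaw (hΨ : Ψ.PosDef) (hν : (p : ℝ) - 1 < ν)
    (Y : Matrix (Fin n) (Fin p) ℝ) :
    predictiveLaw η Ψ ν Y = multivariateTLaw (n + ν + 1 - p) (predictiveLocation η Y)
      (predictiveScale η Ψ ν Y) := by
  rw [predictiveLaw_eq_withDensity η hΨ hν, multivariateTLaw]
  simp only [marginalLikelihood_cons_div η hΨ hν]

end NormalInverseWishart

/-! ### The multivariate t-distribution as a mixture of normal distributions -/

/-- The gamma distribution of the precision factor by which the multivariate t-distribution is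
a mixture of normal distributions. -/
noncomputable def precisionLaw (ν : ℝ) : Measure ℝ :=
  (volume.restrict (Set.Ioi 0)).withDensity fun τ =>
    ENNReal.ofReal ((ν / 2) ^ (ν / 2) / Real.Gamma (ν / 2) *
      (τ ^ (ν / 2 - 1) * Real.exp (-(ν / 2 * τ))))

instance sFinite_precisionLaw (ν : ℝ) : SFinite (precisionLaw ν) := by
  unfold precisionLaw; infer_instance

theorem ae_precisionLaw_pos (ν : ℝ) : ∀ᵐ τ ∂precisionLaw ν, 0 < τ :=
  (withDensity_absolutelyContinuous _ _).ae_le (ae_restrict_mem measurableSet_Ioi)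

section Mixture
variable {q : ℕ} {ν : ℝ} (μ : Fin q → ℝ) {S : Matrix (Fin q) (Fin q) ℝ}

theorem normalPDF_inv_smul (hS : S.PosDef) {τ : ℝ} (hτ : 0 < τ) (y : Fin q → ℝ) :
    normalPDF μ (τ⁻¹ • S) y = (2 * Real.pi) ^ (-(q : ℝ) / 2) * S.det ^ (-(1 / 2) : ℝ) *
      (τ ^ ((q : ℝ) / 2) * Real.exp (-((y - μ) ⬝ᵥ (S⁻¹ *ᵥ (y - μ)) / 2 * τ))) := by
  have hd := hS.det_pos
  have hinv : (τ⁻¹ • S)⁻¹ = τ • S⁻¹ := by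
    refine inv_eq_left_inv ?_
    rw [Matrix.smul_mul, Matrix.mul_smul, nonsing_inv_mul _ hd.ne'.isUnit, smul_smul,
      mul_inv_cancel₀ hτ.ne', one_smul]
  have hdet : (τ⁻¹ • S).det ^ (-(1 / 2) : ℝ) = τ ^ ((q : ℝ) / 2) * S.det ^ (-(1 / 2) : ℝ) := by
    rw [det_smul, Fintype.card_fin, Real.mul_rpow (by positivity) hd.le, ← Real.rpow_natCast,
      ← Real.rpow_mul (by positivity), Real.inv_rpow hτ.le, ← Real.rpow_neg hτ.le]
    congr 2; ring
  rw [normalPDF, hinv, hdet, smul_mulVec, dotProduct_smul, smul_eq_mul]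
  have : -(τ * (y - μ) ⬝ᵥ (S⁻¹ *ᵥ (y - μ))) / 2 = -((y - μ) ⬝ᵥ (S⁻¹ *ᵥ (y - μ)) / 2 * τ) := by
    ring
  rw [this]
  ring

theorem measurable_scaledNormalPDF (S : Matrix (Fin q) (Fin q) ℝ) :
    Measurable (Function.uncurry fun (τ : ℝ) (y : Fin q → ℝ) =>
      ENNReal.ofReal ((2 * Real.pi) ^ (-(q : ℝ) / 2) * S.det ^ (-(1 / 2) : ℝ) *
      (τ ^ ((q : ℝ) / 2) * Real.exp (-((y - μ) ⬝ᵥ (S⁻¹ *ᵥ (y - μ)) / 2 * τ))))) := by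
  unfold Function.uncurry
  have h : Measurable fun w : ℝ × (Fin q → ℝ) => (w.2 - μ) ⬝ᵥ (S⁻¹ *ᵥ (w.2 - μ)) :=
    Continuous.measurable (by fun_prop)
  fun_prop

theorem ae_normalLaw_inv_smul (hS : S.PosDef) :
    ∀ᵐ τ ∂precisionLaw ν, normalLaw μ (τ⁻¹ • S) = volume.withDensity fun y =>
      ENNReal.ofReal ((2 * Real.pi) ^ (-(q : ℝ) / 2) * S.det ^ (-(1 / 2) : ℝ) *
      (τ ^ ((q : ℝ) / 2) * Real.exp (-((y - μ) ⬝ᵥ (S⁻¹ *ᵥ (y - μ)) / 2 * τ)))) := by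
  filter_upwards [ae_precisionLaw_pos ν] with τ hτ
  rw [normalLaw_eq_withDensity μ (hS.smul (inv_pos.2 hτ))]
  simp only [normalPDF_inv_smul μ hS hτ]

/-- Multiplying the normal density of covariance `S / τ` by the gamma density of shape and rate `ν /
2` gives a gamma integrand of shape `(ν + q) / 2` and rate `(ν + Q) / 2`, with `Q` the quadratic
form. Its integral is the t kernel. -/
theorem multivariateTLaw_eq_bind (hν : 0 < ν) (hS : S.PosDef) :
    multivariateTLaw ν μ S = (precisionLaw ν).bind fun τ => normalLaw μ (τ⁻¹ • S) := by
  rw [bind_withDensity_of_ae_eq (measurable_scaledNormalPDF μ S) (ae_normalLaw_inv_smul μ hS),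
    multivariateTLaw]
  congr 1
  funext y
  have hd := hS.det_pos
  have hΓ : 0 < Real.Gamma (ν / 2) := Real.Gamma_pos_of_pos (by positivity)
  set Q := (y - μ) ⬝ᵥ (S⁻¹ *ᵥ (y - μ)) with hQdef
  have hQ : 0 ≤ Q := by
    have h := hS.inv.posSemidef.dotProduct_mulVec_nonneg (y - μ)
    rwa [star_trivial] at h
  have hm : Measurable fun τ : ℝ =>
      ENNReal.ofReal ((2 * Real.pi) ^ (-(q : ℝ) / 2) * S.det ^ (-(1 / 2) : ℝ) *
      (τ ^ ((q : ℝ) / 2) * Real.exp (-(Q / 2 * τ)))) := by fun_prop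
  rw [precisionLaw, lintegral_withDensity_eq_lintegral_mul _ (by fun_prop) hm]
  have h1 : ∀ τ ∈ Set.Ioi (0 : ℝ), ((fun τ => ENNReal.ofReal ((ν / 2) ^ (ν / 2) /
      Real.Gamma (ν / 2) * (τ ^ (ν / 2 - 1) * Real.exp (-(ν / 2 * τ))))) * fun τ : ℝ =>
      ENNReal.ofReal ((2 * Real.pi) ^ (-(q : ℝ) / 2) * S.det ^ (-(1 / 2) : ℝ) *
      (τ ^ ((q : ℝ) / 2) * Real.exp (-(Q / 2 * τ))))) τ =
      ENNReal.ofReal ((ν / 2) ^ (ν / 2) / Real.Gamma (ν / 2) *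
        ((2 * Real.pi) ^ (-(q : ℝ) / 2) * S.det ^ (-(1 / 2) : ℝ))) *
      ENNReal.ofReal (τ ^ ((ν + q) / 2 - 1) * Real.exp (-((ν + Q) / 2 * τ))) := by
    intro τ hτ
    have hτ : 0 < τ := hτ
    rw [Pi.mul_apply, ← ENNReal.ofReal_mul (by positivity), ← ENNReal.ofReal_mul (by positivity)]
    congr 1
    have e1 : τ ^ ((ν + q) / 2 - 1) = τ ^ (ν / 2 - 1) * τ ^ ((q : ℝ) / 2) := by
      rw [← Real.rpow_add hτ]; congr 1; ring
    have e2 : Real.exp (-((ν + Q) / 2 * τ)) =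
        Real.exp (-(ν / 2 * τ)) * Real.exp (-(Q / 2 * τ)) := by
      rw [← Real.exp_add]; congr 1; ring
    rw [e1, e2]
    ring
  rw [setLIntegral_congr_fun measurableSet_Ioi h1, lintegral_const_mul _ (by fun_prop),
    lintegral_rpow_mul_exp_neg_mul (by positivity) (by positivity),
    ← ENNReal.ofReal_mul (by positivity), multivariateTPDF, ← hQdef]
  congr 1
  have e1 : ((ν + Q) / 2) ^ (-((ν + q) / 2)) =
      (ν / 2) ^ (-((ν + q) / 2)) * (1 + 1 / ν * Q) ^ (-(ν + q) / 2) := by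
    rw [neg_div, ← Real.mul_rpow (by positivity) (by positivity)]
    congr 1
    field_simp
  have e2 : (ν / 2) ^ (-((ν + q) / 2)) = ((ν / 2) ^ (ν / 2))⁻¹ * ((ν / 2) ^ ((q : ℝ) / 2))⁻¹ := by
    rw [← Real.rpow_neg (by positivity), ← Real.rpow_neg (by positivity),
      ← Real.rpow_add (by positivity)]
    congr 1; ring
  have e3 : (Real.pi * ν) ^ ((q : ℝ) / 2) =
      (2 * Real.pi) ^ ((q : ℝ) / 2) * (ν / 2) ^ ((q : ℝ) / 2) := by
    rw [← Real.mul_rpow (by positivity) (by positivity)]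
    congr 1; ring
  rw [e1, e2, e3, neg_div 2 (q : ℝ), Real.rpow_neg (x := 2 * Real.pi) (by positivity)]
  field_simp

end Mixture

/-- Projection acts inside the mixture, on normal laws, and taking a submatrix commutes with the
scaling by `τ⁻¹`. -/
theorem multivariateTLaw_map_comp {p q : ℕ} {ν : ℝ} (hν : 0 < ν) (μ : Fin p → ℝ)
    {S : Matrix (Fin p) (Fin p) ℝ} (hS : S.PosDef) (e : Fin q ↪ Fin p) :
    (multivariateTLaw ν μ S).map (fun y j => y (e j)) =
      multivariateTLaw ν (fun j => μ (e j)) (S.submatrix e e) := by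
  have hκ : AEMeasurable (fun τ => normalLaw μ (τ⁻¹ • S)) (precisionLaw ν) :=
    aemeasurable_of_ae_eq_withDensity (measurable_scaledNormalPDF μ S) (ae_normalLaw_inv_smul μ hS)
  rw [multivariateTLaw_eq_bind μ hν hS, measure_map_bind hκ (by fun_prop),
    multivariateTLaw_eq_bind _ hν (hS.submatrix e.injective)]
  refine Measure.bind_congr_right ?_
  filter_upwards [ae_precisionLaw_pos ν] with τ hτ
  rw [normalLaw_map_comp μ (hS.smul (inv_pos.2 hτ)) e]
  rfl

/-! ### The Dirichlet distribution -/

theorem lintegral_beta_scaled {a b c : ℝ} (ha : 0 < a) (hb : 0 < b) (hc : 0 < c) :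
    ∫⁻ t in Set.Ioo 0 c, ENNReal.ofReal ((c - t) ^ (a - 1) * t ^ (b - 1)) =
      ENNReal.ofReal (Real.Gamma a * Real.Gamma b / Real.Gamma (a + b) * c ^ (a + b - 1)) := by
  have himg : (fun x : ℝ => c * x) '' Set.Ioo 0 1 = Set.Ioo 0 c := by
    rw [Set.image_mul_left_Ioo hc]; simp
  have h := lintegral_image_eq_lintegral_abs_deriv_mul (f := fun x : ℝ => c * x)
    (f' := fun _ => c) (s := Set.Ioo 0 1) measurableSet_Ioo
    (fun x _ => by simpa using ((hasDerivAt_id x).const_mul c).hasDerivWithinAt)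
    ((mul_right_injective₀ hc.ne').injOn)
    (fun t => ENNReal.ofReal ((c - t) ^ (a - 1) * t ^ (b - 1)))
  rw [himg] at h
  have hbeta := beta_pos hb ha
  have h1 : ∀ x ∈ Set.Ioo (0 : ℝ) 1,
      ENNReal.ofReal |c| * ENNReal.ofReal ((c - c * x) ^ (a - 1) * (c * x) ^ (b - 1)) =
      ENNReal.ofReal (beta b a * c ^ (a + b - 1)) *
        ENNReal.ofReal (1 / beta b a * x ^ (b - 1) * (1 - x) ^ (a - 1)) := by
    intro x hx
    have hx0 : 0 < x := hx.1
    have hx1 : 0 < 1 - x := sub_pos.2 hx.2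
    rw [← ENNReal.ofReal_mul (abs_nonneg _), ← ENNReal.ofReal_mul (by positivity), abs_of_pos hc]
    congr 1
    have e : c ^ (a + b - 1) = c * c ^ (a - 1) * c ^ (b - 1) := by
      rw [← Real.rpow_one_add' hc.le (by simp [ha.ne']), ← Real.rpow_add hc]; congr 1; ring
    rw [show c - c * x = c * (1 - x) by ring, Real.mul_rpow hc.le hx1.le, Real.mul_rpow hc.le hx0.le,
      e]
    field_simp
  rw [h, setLIntegral_congr_fun measurableSet_Ioo h1, lintegral_const_mul _ (by fun_prop),
    ← lintegral_betaPDF, lintegral_betaPDF_eq_one hb ha, mul_one, beta, mul_comm (Real.Gamma b),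
    add_comm b a]

theorem measurableSet_simplex (n : ℕ) :
    MeasurableSet {x : Fin n → ℝ | (∀ i, 0 < x i) ∧ ∑ i, x i < 1} := by
  have h1 : MeasurableSet {x : Fin n → ℝ | ∀ i, 0 < x i} := by
    have : {x : Fin n → ℝ | ∀ i, 0 < x i} = ⋂ i, {x | 0 < x i} := by ext; simp
    rw [this]
    exact MeasurableSet.iInter fun i => measurableSet_lt measurable_const (measurable_pi_apply i)
  have h2 : Measurable fun x : Fin n → ℝ => ∑ i, x i := by fun_prop
  exact h1.inter (measurableSet_lt h2 measurable_const)

/-- Integrating out the first coordinate over `(0, 1 - ∑ y)` is a scaled beta integral. It leaves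
the same problem in one dimension less with `a + b 0` for `a`, so the induction runs over all `a`.
-/
theorem lintegral_simplex {n : ℕ} {a : ℝ} (ha : 0 < a) {b : Fin n → ℝ} (hb : ∀ i, 0 < b i) :
    ∫⁻ x in {x : Fin n → ℝ | (∀ i, 0 < x i) ∧ ∑ i, x i < 1},
        ENNReal.ofReal ((1 - ∑ i, x i) ^ (a - 1) * ∏ i, x i ^ (b i - 1)) =
      ENNReal.ofReal (Real.Gamma a * (∏ i, Real.Gamma (b i)) / Real.Gamma (a + ∑ i, b i)) := by
  induction n generalizing a with
  | zero =>
    have hΓ := (Real.Gamma_pos_of_pos ha).ne'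
    have hvol : (volume : Measure (Fin 0 → ℝ)) Set.univ = 1 := by
      rw [volume_pi, Measure.pi_of_empty]; simp
    simp [hΓ, hvol]
  | succ n ih =>
    have hmp := (volume_preserving_piFinSuccAbove (fun _ : Fin (n + 1) => ℝ) 0).symm
    have hF : Measurable fun x : Fin (n + 1) → ℝ =>
        ENNReal.ofReal ((1 - ∑ i, x i) ^ (a - 1) * ∏ i, x i ^ (b i - 1)) := by fun_prop
    have hcons : ∀ w : ℝ × (Fin n → ℝ),
        (MeasurableEquiv.piFinSuccAbove (fun _ : Fin (n + 1) => ℝ) 0).symm w =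
          (Fin.cons w.1 w.2 : Fin (n + 1) → ℝ) := fun w => Fin.insertNth_zero' _ _
    have hFi := hF.indicator (measurableSet_simplex (n + 1))
    rw [← lintegral_indicator (measurableSet_simplex _), ← hmp.lintegral_comp hFi,
      Measure.volume_eq_prod, lintegral_prod_symm _ (hFi.fun_comp hmp.measurable).aemeasurable]
    simp only [hcons]
    have hΓa := Real.Gamma_pos_of_pos ha
    have hΓb := Real.Gamma_pos_of_pos (hb 0)
    have hΓab := Real.Gamma_pos_of_pos (add_pos ha (hb 0))
    have inner : ∀ y : Fin n → ℝ,
        ∫⁻ t : ℝ, {x : Fin (n + 1) → ℝ | (∀ i, 0 < x i) ∧ ∑ i, x i < 1}.indicator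
          (fun x => ENNReal.ofReal ((1 - ∑ i, x i) ^ (a - 1) * ∏ i, x i ^ (b i - 1)))
          (Fin.cons t y : Fin (n + 1) → ℝ) =
        {y : Fin n → ℝ | (∀ i, 0 < y i) ∧ ∑ i, y i < 1}.indicator (fun y =>
          ENNReal.ofReal (Real.Gamma a * Real.Gamma (b 0) / Real.Gamma (a + b 0)) *
          ENNReal.ofReal ((1 - ∑ i, y i) ^ (a + b 0 - 1) * ∏ i, y i ^ (b i.succ - 1))) y := by
      intro y
      by_cases hy : (∀ i, 0 < y i) ∧ ∑ i, y i < 1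
      · rw [Set.indicator_of_mem (by exact hy)]
        have hc : 0 < 1 - ∑ i, y i := sub_pos.2 hy.2
        have hP : 0 ≤ ∏ i, y i ^ (b i.succ - 1) :=
          Finset.prod_nonneg fun i _ => Real.rpow_nonneg (hy.1 i).le _
        have h1 : ∀ t : ℝ, {x : Fin (n + 1) → ℝ | (∀ i, 0 < x i) ∧ ∑ i, x i < 1}.indicator
            (fun x => ENNReal.ofReal ((1 - ∑ i, x i) ^ (a - 1) * ∏ i, x i ^ (b i - 1)))
            (Fin.cons t y : Fin (n + 1) → ℝ) =
            (Set.Ioo 0 (1 - ∑ i, y i)).indicator (fun t =>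
              ENNReal.ofReal (∏ i, y i ^ (b i.succ - 1)) *
              ENNReal.ofReal ((1 - ∑ i, y i - t) ^ (a - 1) * t ^ (b 0 - 1))) t := by
          intro t
          have hiff : (Fin.cons t y : Fin (n + 1) → ℝ) ∈
              {x : Fin (n + 1) → ℝ | (∀ i, 0 < x i) ∧ ∑ i, x i < 1} ↔
              t ∈ Set.Ioo 0 (1 - ∑ i, y i) := by
            change (∀ i, 0 < (Fin.cons t y : Fin (n + 1) → ℝ) i) ∧
              ∑ i, (Fin.cons t y : Fin (n + 1) → ℝ) i < 1 ↔ _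
            rw [Fin.forall_fin_succ, Fin.sum_univ_succ]
            simp only [Fin.cons_zero, Fin.cons_succ, Set.mem_Ioo]
            constructor
            · rintro ⟨⟨h1, -⟩, h2⟩; exact ⟨h1, by linarith⟩
            · rintro ⟨h1, h2⟩; exact ⟨⟨h1, hy.1⟩, by linarith⟩
          by_cases ht : t ∈ Set.Ioo 0 (1 - ∑ i, y i)
          · rw [Set.indicator_of_mem (hiff.2 ht), Set.indicator_of_mem ht,
              ← ENNReal.ofReal_mul hP, Fin.sum_univ_succ, Fin.prod_univ_succ]
            simp only [Fin.cons_zero, Fin.cons_succ]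
            congr 1
            rw [show 1 - (t + ∑ i, y i) = 1 - ∑ i, y i - t by ring]
            ring
          · rw [Set.indicator_of_notMem (hiff.not.2 ht), Set.indicator_of_notMem ht]
        simp_rw [h1]
        rw [lintegral_indicator measurableSet_Ioo, lintegral_const_mul _ (by fun_prop),
          lintegral_beta_scaled ha (hb 0) hc, ← ENNReal.ofReal_mul hP,
          ← ENNReal.ofReal_mul (by positivity)]
        congr 1
        ring
      -- If `y` is outside the smaller simplex, no `t` puts `(t, y)` inside the larger one, because
      -- `t > 0` and `t + ∑ y < 1` force `∑ y < 1`.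
      · rw [Set.indicator_of_notMem (by exact hy)]
        refine (lintegral_congr fun t => Set.indicator_of_notMem ?_ _).trans lintegral_zero
        rintro ⟨h1, h2⟩
        rw [Fin.forall_fin_succ] at h1
        rw [Fin.sum_univ_succ] at h2
        simp only [Fin.cons_zero, Fin.cons_succ] at h1 h2
        exact hy ⟨h1.2, by linarith [h1.1]⟩
    rw [lintegral_congr inner, lintegral_indicator (measurableSet_simplex n),
      lintegral_const_mul _ (by fun_prop), ih (add_pos ha (hb 0)) fun i => hb i.succ,
      ← ENNReal.ofReal_mul (by positivity), Fin.prod_univ_succ, Fin.sum_univ_succ, ← add_assoc]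
    congr 1
    field_simp

theorem measurable_cons_one_sub_sum (n : ℕ) : Measurable fun x : Fin n → ℝ =>
    (Fin.cons (1 - ∑ i, x i) x : Fin (n + 1) → ℝ) := by
  refine measurable_pi_iff.2 fun i => ?_
  induction i using Fin.cases with
  | zero => simp only [Fin.cons_zero]; fun_prop
  | succ i => simp only [Fin.cons_succ]; fun_prop

/-- Positivity of the coordinates is what allows real and natural powers of `w k` to be merged. -/
theorem ae_simplexVolume_pos (K : ℕ) : ∀ᵐ w ∂simplexVolume K, ∀ i, 0 < w i := by
  cases K with
  | zero => simp [simplexVolume]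
  | succ n =>
    have hpos : MeasurableSet {w : Fin (n + 1) → ℝ | ∀ i, 0 < w i} := by
      have : {x : Fin (n + 1) → ℝ | ∀ i, 0 < x i} = ⋂ i, {x | 0 < x i} := by ext; simp
      rw [this]
      exact MeasurableSet.iInter fun i => measurableSet_lt measurable_const (measurable_pi_apply i)
    rw [simplexVolume, ae_map_iff (measurable_cons_one_sub_sum n).aemeasurable hpos]
    filter_upwards [ae_restrict_mem (measurableSet_simplex n)] with x hx
    rw [Fin.forall_fin_succ]
    simp only [Fin.cons_zero, Fin.cons_succ]
    exact ⟨sub_pos.2 hx.2, hx.1⟩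

theorem measurable_dirichletDensity {K : ℕ} (α : Fin K → ℝ) : Measurable fun w : Fin K → ℝ =>
    ENNReal.ofReal (Real.Gamma (∑ k, α k) * ∏ k, (w k ^ (α k - 1) / Real.Gamma (α k))) := by
  fun_prop

theorem isProbabilityMeasure_dirichletLaw {K : ℕ} (hK : 0 < K) {α : Fin K → ℝ}
    (hα : ∀ k, 0 < α k) : IsProbabilityMeasure (dirichletLaw α) := by
  refine ⟨?_⟩
  obtain ⟨n, rfl⟩ := Nat.exists_eq_succ_of_ne_zero hK.ne'
  rw [dirichletLaw, withDensity_apply _ .univ, Measure.restrict_univ, simplexVolume,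
    lintegral_map (measurable_dirichletDensity α) (measurable_cons_one_sub_sum n)]
  have hΓ : ∀ k, 0 < Real.Gamma (α k) := fun k => Real.Gamma_pos_of_pos (hα k)
  have hsum : 0 < ∑ k, α k := Finset.sum_pos (fun k _ => hα k) Finset.univ_nonempty
  have hΓs := Real.Gamma_pos_of_pos hsum
  have hP : 0 < ∏ k, Real.Gamma (α k) := Finset.prod_pos fun k _ => hΓ k
  have h1 : ∀ x : Fin n → ℝ, ENNReal.ofReal (Real.Gamma (∑ k, α k) *
      ∏ k, ((Fin.cons (1 - ∑ i, x i) x : Fin (n + 1) → ℝ) k ^ (α k - 1) / Real.Gamma (α k))) =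
      ENNReal.ofReal (Real.Gamma (∑ k, α k) / ∏ k, Real.Gamma (α k)) *
      ENNReal.ofReal ((1 - ∑ i, x i) ^ (α 0 - 1) * ∏ i, x i ^ (α (Fin.succ i) - 1)) := by
    intro x
    rw [← ENNReal.ofReal_mul (by positivity), Finset.prod_div_distrib,
      Fin.prod_univ_succ fun k => (Fin.cons (1 - ∑ i, x i) x : Fin (n + 1) → ℝ) k ^ (α k - 1)]
    simp only [Fin.cons_zero, Fin.cons_succ]
    congr 1
    ring
  simp_rw [h1]
  rw [lintegral_const_mul _ (by fun_prop), lintegral_simplex (hα 0) fun i => hα i.succ,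
    ← ENNReal.ofReal_mul (by positivity), ← Fin.prod_univ_succ fun k => Real.Gamma (α k),
    ← Fin.sum_univ_succ]
  rw [← ENNReal.ofReal_one]
  congr 1
  field_simp

theorem dirichletDensity_mul {K : ℕ} {α : Fin K → ℝ} (hK : 0 < K) (hα : ∀ k, 0 < α k)
    (N : Fin K → ℕ) {w : Fin K → ℝ} (hw : ∀ k, 0 < w k) :
    ENNReal.ofReal (Real.Gamma (∑ k, α k) * ∏ k, (w k ^ (α k - 1) / Real.Gamma (α k))) *
        ∏ k, ENNReal.ofReal (w k) ^ N k =
      ENNReal.ofReal (Real.Gamma (∑ k, α k) / Real.Gamma (∑ k, (N k + α k)) *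
        ∏ k, (Real.Gamma (N k + α k) / Real.Gamma (α k))) *
      ENNReal.ofReal (Real.Gamma (∑ k, (N k + α k)) *
        ∏ k, (w k ^ (N k + α k - 1) / Real.Gamma (N k + α k))) := by
  have : Nonempty (Fin K) := ⟨⟨0, hK⟩⟩
  have hα' : ∀ k, 0 < N k + α k := fun k => add_pos_of_nonneg_of_pos (Nat.cast_nonneg _) (hα k)
  have hΓ : ∀ k, 0 < Real.Gamma (α k) := fun k => Real.Gamma_pos_of_pos (hα k)
  have hΓ' : ∀ k, 0 < Real.Gamma (N k + α k) := fun k => Real.Gamma_pos_of_pos (hα' k)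
  have hs := Real.Gamma_pos_of_pos (Finset.sum_pos (fun k _ => hα k) Finset.univ_nonempty)
  have hs' := Real.Gamma_pos_of_pos (Finset.sum_pos (fun k _ => hα' k) Finset.univ_nonempty)
  have h1 : 0 ≤ ∏ k, (w k ^ (α k - 1) / Real.Gamma (α k)) :=
    Finset.prod_nonneg fun k _ => div_nonneg (Real.rpow_nonneg (hw k).le _) (hΓ k).le
  have h2 : 0 ≤ ∏ k, (Real.Gamma (N k + α k) / Real.Gamma (α k)) :=
    Finset.prod_nonneg fun k _ => div_nonneg (hΓ' k).le (hΓ k).le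
  have h3 : ∏ k, ENNReal.ofReal (w k) ^ N k = ENNReal.ofReal (∏ k, w k ^ N k) := by
    rw [ENNReal.ofReal_prod_of_nonneg fun k _ => pow_nonneg (hw k).le _]
    exact Finset.prod_congr rfl fun k _ => (ENNReal.ofReal_pow (hw k).le _).symm
  have h4 : (∏ k, (w k ^ (α k - 1) / Real.Gamma (α k))) * ∏ k, w k ^ N k =
      (∏ k, (Real.Gamma (N k + α k) / Real.Gamma (α k))) *
        ∏ k, (w k ^ (N k + α k - 1) / Real.Gamma (N k + α k)) := by
    rw [← Finset.prod_mul_distrib, ← Finset.prod_mul_distrib]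
    refine Finset.prod_congr rfl fun k _ => ?_
    have e : w k ^ (N k + α k - 1) = w k ^ (α k - 1) * w k ^ N k := by
      rw [← Real.rpow_natCast, ← Real.rpow_add (hw k)]; congr 1; ring
    have := (hΓ k).ne'
    have := (hΓ' k).ne'
    rw [e]
    field_simp
  rw [h3, ← ENNReal.ofReal_mul (by positivity), ← ENNReal.ofReal_mul (by positivity), mul_assoc, h4]
  congr 1
  field_simp

/-- The monomial moves the exponents to those of another Dirichlet density, which has mass one, so
the moment is a ratio of normalizing constants. -/
theorem lintegral_prod_pow_dirichletLaw {K : ℕ} (hK : 0 < K) {α : Fin K → ℝ} (hα : ∀ k, 0 < α k)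
    (N : Fin K → ℕ) : ∫⁻ w, ∏ k, ENNReal.ofReal (w k) ^ N k ∂dirichletLaw α =
      ENNReal.ofReal (Real.Gamma (∑ k, α k) / Real.Gamma (∑ k, (N k + α k)) *
        ∏ k, (Real.Gamma (N k + α k) / Real.Gamma (α k))) := by
  have h := isProbabilityMeasure_dirichletLaw hK (α := fun k => N k + α k)
    fun k => add_pos_of_nonneg_of_pos (Nat.cast_nonneg _) (hα k)
  have h1 := h.measure_univ
  rw [dirichletLaw, withDensity_apply _ .univ, Measure.restrict_univ] at h1
  rw [dirichletLaw, lintegral_withDensity_eq_lintegral_mul _ (measurable_dirichletDensity α)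
    (by fun_prop)]
  refine (lintegral_congr_ae (g := fun w => ENNReal.ofReal (Real.Gamma (∑ k, α k) /
      Real.Gamma (∑ k, (N k + α k)) * ∏ k, (Real.Gamma (N k + α k) / Real.Gamma (α k))) *
      ENNReal.ofReal (Real.Gamma (∑ k, (N k + α k)) *
        ∏ k, (w k ^ (N k + α k - 1) / Real.Gamma (N k + α k)))) ?_).trans ?_
  · filter_upwards [ae_simplexVolume_pos K] with w hw
    exact dirichletDensity_mul hK hα N hw
  · rw [lintegral_const_mul _ (measurable_dirichletDensity _), h1, mul_one]

theorem lintegral_apply_dirichletLaw {K : ℕ} (hK : 0 < K) {α : Fin K → ℝ} (hα : ∀ k, 0 < α k)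
    (k : Fin K) : ∫⁻ w, ENNReal.ofReal (w k) ∂dirichletLaw α =
      ENNReal.ofReal (α k / ∑ j, α j) := by
  classical
  have : Nonempty (Fin K) := ⟨k⟩
  -- The mean is the moment with a single count in category `k`; `Γ(x + 1) = x Γ(x)` then leaves `α
  -- k / ∑ α`.
  have h := lintegral_prod_pow_dirichletLaw hK hα (Pi.single k 1)
  have h1 : ∀ w : Fin K → ℝ, ∏ j, ENNReal.ofReal (w j) ^ (Pi.single k 1 : Fin K → ℕ) j =
      ENNReal.ofReal (w k) := by
    intro w
    rw [Finset.prod_eq_single k]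
    · simp
    · intro j _ hj; simp [hj]
    · simp
  have hs : 0 < ∑ j, α j := Finset.sum_pos (fun k _ => hα k) Finset.univ_nonempty
  have h2 : ∑ j, (((Pi.single k 1 : Fin K → ℕ) j : ℝ) + α j) = ∑ j, α j + 1 := by
    rw [Finset.sum_add_distrib, add_comm]
    congr 1
    rw [Finset.sum_eq_single k]
    · simp
    · intro j _ hj; simp [hj]
    · simp
  have h3 : ∏ j, (Real.Gamma (((Pi.single k 1 : Fin K → ℕ) j : ℝ) + α j) / Real.Gamma (α j)) =
      α k := by
    rw [Finset.prod_eq_single k]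
    · have := (Real.Gamma_pos_of_pos (hα k)).ne'
      rw [Pi.single_eq_same, Nat.cast_one, add_comm, Real.Gamma_add_one (hα k).ne']
      field_simp
    · intro j _ hj
      rw [Pi.single_eq_of_ne hj, Nat.cast_zero, zero_add,
        div_self (Real.Gamma_pos_of_pos (hα j)).ne']
    · simp
  simp only [h1] at h
  rw [h, h2, h3, Real.Gamma_add_one hs.ne']
  have := (Real.Gamma_pos_of_pos hs).ne'
  congr 1
  field_simp

theorem posteriorLaw_dirichletLaw {K : ℕ} (hK : 0 < K) {α : Fin K → ℝ} (hα : ∀ k, 0 < α k)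
    (N : Fin K → ℕ) :
    posteriorLaw (dirichletLaw α) (fun w => ∏ k, ENNReal.ofReal (w k) ^ N k) =
      dirichletLaw fun k => N k + α k := by
  have : Nonempty (Fin K) := ⟨⟨0, hK⟩⟩
  have hα' : ∀ k, 0 < N k + α k := fun k => add_pos_of_nonneg_of_pos (Nat.cast_nonneg _) (hα k)
  have hs := Real.Gamma_pos_of_pos (Finset.sum_pos (fun k _ => hα k) Finset.univ_nonempty)
  have hs' := Real.Gamma_pos_of_pos (Finset.sum_pos (fun k _ => hα' k) Finset.univ_nonempty)
  have hr : 0 < Real.Gamma (∑ k, α k) / Real.Gamma (∑ k, (N k + α k)) *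
      ∏ k, (Real.Gamma (N k + α k) / Real.Gamma (α k)) :=
    mul_pos (div_pos hs hs') (Finset.prod_pos fun k _ =>
      div_pos (Real.Gamma_pos_of_pos (hα' k)) (Real.Gamma_pos_of_pos (hα k)))
  have hL : Measurable fun w : Fin K → ℝ => ∏ k, ENNReal.ofReal (w k) ^ N k := by fun_prop
  rw [posteriorLaw, lintegral_prod_pow_dirichletLaw hK hα]
  conv_lhs => rw [dirichletLaw]
  rw [← withDensity_mul _ (measurable_dirichletDensity α) hL,
    withDensity_congr_ae (g := fun w => ENNReal.ofReal (Real.Gamma (∑ k, α k) /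
      Real.Gamma (∑ k, (N k + α k)) * ∏ k, (Real.Gamma (N k + α k) / Real.Gamma (α k))) *
      ENNReal.ofReal (Real.Gamma (∑ k, (N k + α k)) *
        ∏ k, (w k ^ (N k + α k - 1) / Real.Gamma (N k + α k)))) ?_]
  · rw [← withDensity_smul _ ((measurable_dirichletDensity fun k => N k + α k).const_mul _),
      dirichletLaw]
    congr 1
    funext w
    rw [Pi.smul_apply, smul_eq_mul, ← mul_assoc,
      ENNReal.inv_mul_cancel (ENNReal.ofReal_pos.2 hr).ne' ENNReal.ofReal_ne_top, one_mul]
  · filter_upwards [ae_simplexVolume_pos K] with w hw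
    exact dirichletDensity_mul hK hα N hw

/-! ### Posteriors of independent parameters -/

/-- Numerator and evidence both factor. The evidence of `f` must be nonzero and finite, since
inversion is not multiplicative on `0 * ∞`. -/
theorem posteriorLaw_prod {A B : Type*} [MeasurableSpace A] [MeasurableSpace B]
    (μ : Measure A) [SFinite μ] (ρ : Measure B) [SFinite ρ] {f : A → ℝ≥0∞} {g : B → ℝ≥0∞}
    (hf : Measurable f) (hg : Measurable g) (hf0 : ∫⁻ a, f a ∂μ ≠ 0) (hft : ∫⁻ a, f a ∂μ ≠ ∞) :
    posteriorLaw (μ.prod ρ) (fun θ => f θ.1 * g θ.2) =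
      (posteriorLaw μ f).prod (posteriorLaw ρ g) := by
  rw [posteriorLaw, posteriorLaw, posteriorLaw, Measure.prod_smul_left, Measure.prod_smul_right,
    prod_withDensity hf hg, smul_smul, lintegral_prod_mul hf.aemeasurable hg.aemeasurable,
    ENNReal.mul_inv (Or.inl hf0) (Or.inl hft)]

theorem posteriorLaw_pi {n : ℕ} {X : Fin n → Type*} [∀ i, MeasurableSpace (X i)]
    (μ : ∀ i, Measure (X i)) [∀ i, SigmaFinite (μ i)] {f : ∀ i, X i → ℝ≥0∞}
    (hf : ∀ i, Measurable (f i)) (h0 : ∀ i, ∫⁻ x, f i x ∂μ i ≠ 0)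
    (ht : ∀ i, ∫⁻ x, f i x ∂μ i ≠ ∞) :
    posteriorLaw (Measure.pi μ) (fun x => ∏ i, f i (x i)) =
      Measure.pi fun i => posteriorLaw (μ i) (f i) := by
  have := fun i => isProbabilityMeasure_posteriorLaw (h0 i) (ht i)
  refine (Measure.pi_eq fun s hs => ?_).symm
  simp only [posteriorLaw, Measure.smul_apply, smul_eq_mul]
  rw [withDensity_apply _ (MeasurableSet.univ_pi hs), Measure.restrict_pi_pi,
    lintegral_pi_prod_eq_prod_lintegral _ _ hf, lintegral_pi_prod_eq_prod_lintegral _ _ hf,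
    ENNReal.prod_inv_distrib fun i _ j _ _ => Or.inl (h0 i), ← Finset.prod_mul_distrib]
  exact Finset.prod_congr rfl fun i _ => by rw [withDensity_apply _ (hs i)]

/-! ### The mixture model -/

instance isProbabilityMeasure_predictiveLaw {n p : ℕ} (η : Fin p → ℝ)
    (Ψ : Matrix (Fin p) (Fin p) ℝ) (ν : ℝ) (Y : Matrix (Fin n) (Fin p) ℝ)
    [IsProbabilityMeasure (niwPosterior η Ψ ν Y)] :
    IsProbabilityMeasure (predictiveLaw η Ψ ν Y) := by
  refine ⟨?_⟩
  rw [predictiveLaw, Measure.bind_apply .univ (aemeasurable_normalLaw_niwPosterior η Y)]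
  simp

/-- A measurable family of measures which agrees with the normal laws at positive definite
covariance matrices. -/
noncomputable def normalDensityLaw {p : ℕ} (θ : CategoryParam p) : Measure (Fin p → ℝ) :=
  volume.withDensity fun y => ENNReal.ofReal (normalPDF θ.1 θ.cov y)

theorem measurable_normalDensityLaw {p : ℕ} : Measurable (normalDensityLaw (p := p)) := by
  refine Measure.measurable_of_measurable_coe _ fun s hs => ?_
  simp only [normalDensityLaw, withDensity_apply _ hs]
  exact Measurable.lintegral_prod_right' (ν := volume.restrict s)
    measurable_normalPDF_prod.ennreal_ofReal

theorem predictiveLaw_apply {n p : ℕ} (η : Fin p → ℝ) (Ψ : Matrix (Fin p) (Fin p) ℝ) (ν : ℝ)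
    (Y : Matrix (Fin n) (Fin p) ℝ) {s : Set (Fin p → ℝ)} (hs : MeasurableSet s) :
    predictiveLaw η Ψ ν Y s = ∫⁻ θ, normalDensityLaw θ s ∂niwPosterior η Ψ ν Y := by
  rw [predictiveLaw, Measure.bind_apply hs (aemeasurable_normalLaw_niwPosterior η Y)]
  refine lintegral_congr_ae ?_
  filter_upwards [ae_niwPosterior_posDef η Y] with θ hθ
  rw [normalLaw_eq_withDensity θ.1 hθ, normalDensityLaw]

section Model
variable {K p : ℕ} {N : Fin K → ℕ} {α : Fin K → ℝ} (η : Fin K → Fin p → ℝ)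
  {Ψ : Fin K → Matrix (Fin p) (Fin p) ℝ} {ν : Fin K → ℝ}

theorem modelPosterior_eq (hK : 0 < K) (hα : ∀ k, 0 < α k) (hΨ : ∀ k, (Ψ k).PosDef)
    (hν : ∀ k, (p : ℝ) - 1 < ν k) (Y : (k : Fin K) → Matrix (Fin (N k)) (Fin p) ℝ) :
    modelPosterior α η Ψ ν Y = (dirichletLaw fun k => N k + α k).prod
      (Measure.pi fun k => niwPosterior (η k) (Ψ k) (ν k) (Y k)) := by
  have := isProbabilityMeasure_dirichletLaw hK hα
  have := fun k => isProbabilityMeasure_niwPrior (η k) (hΨ k) (hν k)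
  -- The categories of the training data are known, so `π` enters only through the monomial with
  -- exponents `N k`.
  have hL : (modelLikelihood Y) = fun θ : ModelParam K p =>
      (∏ k, ENNReal.ofReal (θ.1 k) ^ N k) * ∏ k, categoryLikelihood (Y k) (θ.2 k) := by
    funext θ
    simp only [modelLikelihood, categoryLikelihood, Finset.prod_mul_distrib, Finset.prod_const,
      Finset.card_univ, Fintype.card_fin]
  have hc := lintegral_prod_pow_dirichletLaw hK hα N
  have hnonempty : Nonempty (Fin K) := ⟨⟨0, hK⟩⟩
  have hα' : ∀ k, 0 < N k + α k := fun k => add_pos_of_nonneg_of_pos (Nat.cast_nonneg _) (hα k)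
  have hpos : 0 < Real.Gamma (∑ k, α k) / Real.Gamma (∑ k, (N k + α k)) *
      ∏ k, (Real.Gamma (N k + α k) / Real.Gamma (α k)) :=
    mul_pos (div_pos
      (Real.Gamma_pos_of_pos (Finset.sum_pos (fun k _ => hα k) Finset.univ_nonempty))
      (Real.Gamma_pos_of_pos (Finset.sum_pos (fun k _ => hα' k) Finset.univ_nonempty)))
      (Finset.prod_pos fun k _ =>
        div_pos (Real.Gamma_pos_of_pos (hα' k)) (Real.Gamma_pos_of_pos (hα k)))
  have hm : ∀ k, Measurable (categoryLikelihood (Y k)) :=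
    fun k => measurable_categoryLikelihood (Y k)
  have hmp : Measurable fun θ : Fin K → CategoryParam p =>
      ∏ k, categoryLikelihood (Y k) (θ k) :=
    Finset.measurable_prod _ fun k _ => (hm k).comp (measurable_pi_apply k)
  rw [modelPosterior, modelPrior, hL, posteriorLaw_prod (dirichletLaw α) _
    (f := fun w => ∏ k, ENNReal.ofReal (w k) ^ N k)
    (g := fun θ : Fin K → CategoryParam p => ∏ k, categoryLikelihood (Y k) (θ k))
    (by fun_prop) hmp (hc ▸ (ENNReal.ofReal_pos.2 hpos).ne') (hc ▸ ENNReal.ofReal_ne_top),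
    posteriorLaw_dirichletLaw hK hα, posteriorLaw_pi _ hm
      (fun k => marginalLikelihood_ne_zero (η k) (hΨ k) (hν k) (Y k))
      (fun k => marginalLikelihood_ne_top (η k) (hΨ k) (hν k) (Y k))]
  rfl

/-- Under the product posterior, the integral of `π_k` times a normal probability factors into the
Dirichlet mean of `π_k` and a probability under the predictive law of category `k`. -/
theorem newEventPredictiveLaw_apply (hK : 0 < K) (hα : ∀ k, 0 < α k) (hΨ : ∀ k, (Ψ k).PosDef)
    (hν : ∀ k, (p : ℝ) - 1 < ν k) (Y : (k : Fin K) → Matrix (Fin (N k)) (Fin p) ℝ)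
    {s : Set (Fin K × (Fin p → ℝ))} (hs : MeasurableSet s) :
    newEventPredictiveLaw α η Ψ ν Y s =
      ∑ k, ENNReal.ofReal ((N k + α k) / ∑ j, (N j + α j)) *
        predictiveLaw (η k) (Ψ k) (ν k) (Y k) (Prod.mk k ⁻¹' s) := by
  have hα' : ∀ k, 0 < N k + α k := fun k => add_pos_of_nonneg_of_pos (Nat.cast_nonneg _) (hα k)
  have := isProbabilityMeasure_dirichletLaw hK hα'
  have := fun k => isProbabilityMeasure_niwPosterior (η k) (hΨ k) (hν k) (Y k)
  have hmk : ∀ k : Fin K, Measurable (Prod.mk k : (Fin p → ℝ) → Fin K × (Fin p → ℝ)) :=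
    fun k => measurable_prodMk_left
  have hpre : ∀ k : Fin K, MeasurableSet (Prod.mk k ⁻¹' s) := fun k => hmk k hs
  have hG : ∀ (t : Set (Fin p → ℝ)), MeasurableSet t →
      Measurable fun θ : CategoryParam p => normalDensityLaw θ t :=
    fun t ht => (Measure.measurable_coe ht).comp measurable_normalDensityLaw
  have hGk : ∀ (k : Fin K) (t : Set (Fin p → ℝ)), MeasurableSet t →
      Measurable fun θ : Fin K → CategoryParam p => normalDensityLaw (θ k) t :=
    fun k t ht => (hG t ht).comp (measurable_pi_apply k)
  have hw : ∀ k : Fin K, Measurable fun w : Fin K → ℝ => ENNReal.ofReal (w k) := fun k => by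
    fun_prop
  have hpos : ∀ᵐ θ ∂modelPosterior α η Ψ ν Y, ∀ k, (θ.2 k).cov.PosDef := by
    rw [modelPosterior_eq η hK hα hΨ hν Y, ae_all_iff]
    intro k
    have h := (Measure.quasiMeasurePreserving_eval
      (fun k => niwPosterior (η k) (Ψ k) (ν k) (Y k)) k).ae (ae_niwPosterior_posDef (η k) (Y k))
    exact Measure.quasiMeasurePreserving_snd.ae h
  -- Almost surely the event law agrees with a version built from densities, which is measurable in
  -- the parameters.
  have hae : ∀ᵐ θ ∂modelPosterior α η Ψ ν Y, newEventLaw θ =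
      ∑ k, ENNReal.ofReal (θ.1 k) • (normalDensityLaw (θ.2 k)).map (Prod.mk k) := by
    filter_upwards [hpos] with θ hθ
    refine Finset.sum_congr rfl fun k _ => ?_
    rw [Measure.dirac_prod, normalLaw_eq_withDensity _ (hθ k), normalDensityLaw]
  have happ : ∀ (θ : ModelParam K p) {t : Set (Fin K × (Fin p → ℝ))}, MeasurableSet t →
      (∑ k, ENNReal.ofReal (θ.1 k) • (normalDensityLaw (θ.2 k)).map (Prod.mk k)) t =
        ∑ k, ENNReal.ofReal (θ.1 k) * normalDensityLaw (θ.2 k) (Prod.mk k ⁻¹' t) := by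
    intro θ t ht
    rw [Measure.finsetSum_apply]
    refine Finset.sum_congr rfl fun k _ => ?_
    rw [Measure.smul_apply, Measure.map_apply (hmk k) ht, smul_eq_mul]
  have hterm : ∀ (k : Fin K) {t : Set (Fin K × (Fin p → ℝ))}, MeasurableSet t →
      Measurable fun θ : ModelParam K p =>
        ENNReal.ofReal (θ.1 k) * normalDensityLaw (θ.2 k) (Prod.mk k ⁻¹' t) :=
    fun k t ht => ((hw k).comp measurable_fst).mul ((hGk k _ (hmk k ht)).comp measurable_snd)
  have hmeas : AEMeasurable newEventLaw (modelPosterior α η Ψ ν Y) := by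
    refine ⟨_, Measure.measurable_of_measurable_coe _ fun t ht => ?_, hae⟩
    simp only [happ _ ht]
    exact Finset.measurable_sum _ fun k _ => hterm k ht
  have hint : ∫⁻ θ, newEventLaw θ s ∂modelPosterior α η Ψ ν Y =
      ∫⁻ θ, ∑ k, ENNReal.ofReal (θ.1 k) * normalDensityLaw (θ.2 k) (Prod.mk k ⁻¹' s)
        ∂modelPosterior α η Ψ ν Y := by
    refine lintegral_congr_ae ?_
    filter_upwards [hae] with θ hθ
    rw [hθ, happ θ hs]
  rw [newEventPredictiveLaw, Measure.bind_apply hs hmeas, hint,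
    lintegral_finsetSum _ fun k _ => hterm k hs, modelPosterior_eq η hK hα hΨ hν Y]
  refine Finset.sum_congr rfl fun k _ => ?_
  rw [lintegral_prod_mul (f := fun w : Fin K → ℝ => ENNReal.ofReal (w k))
      (g := fun θ : Fin K → CategoryParam p => normalDensityLaw (θ k) (Prod.mk k ⁻¹' s))
      (hw k).aemeasurable (hGk k _ (hpre k)).aemeasurable,
    lintegral_apply_dirichletLaw hK hα', predictiveLaw_apply _ _ _ _ (hpre k)]
  congr 1
  exact (measurePreserving_eval (fun k => niwPosterior (η k) (Ψ k) (ν k) (Y k)) k).lintegral_comp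
    (hG _ (hpre k))

theorem newEventPredictiveLaw_fst_preimage_inter (hK : 0 < K) (hα : ∀ k, 0 < α k)
    (hΨ : ∀ k, (Ψ k).PosDef) (hν : ∀ k, (p : ℝ) - 1 < ν k)
    (Y : (k : Fin K) → Matrix (Fin (N k)) (Fin p) ℝ) (k : Fin K) {t : Set (Fin p → ℝ)}
    (ht : MeasurableSet t) :
    newEventPredictiveLaw α η Ψ ν Y (Prod.fst ⁻¹' {k} ∩ Prod.snd ⁻¹' t) =
      ENNReal.ofReal ((N k + α k) / ∑ j, (N j + α j)) *
        predictiveLaw (η k) (Ψ k) (ν k) (Y k) t := by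
  have hk : MeasurableSet (Prod.fst ⁻¹' {k} : Set (Fin K × (Fin p → ℝ))) :=
    measurable_fst (measurableSet_singleton k)
  rw [newEventPredictiveLaw_apply η hK hα hΨ hν Y (hk.inter (measurable_snd ht)),
    Finset.sum_eq_single k]
  · congr 2
    ext y; simp
  · intro j _ hj
    have : (Prod.mk j ⁻¹' (Prod.fst ⁻¹' {k} ∩ Prod.snd ⁻¹' t) : Set (Fin p → ℝ)) = ∅ := by
      ext y; simp [hj]
    rw [this, measure_empty, mul_zero]
  · simp

end Model

/-! ### The three parts of the theorem -/

theorem mainTheorem2 {K p : ℕ} (hK : 0 < K) (N : Fin K → ℕ)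
    (α : Fin K → ℝ) (hα : ∀ k, 0 < α k)
    (η : Fin K → Fin p → ℝ)
    (Ψ : Fin K → Matrix (Fin p) (Fin p) ℝ) (hΨ : ∀ k, (Ψ k).PosDef)
    (ν : Fin K → ℝ) (hν : ∀ k, (p : ℝ) - 1 < ν k) :
    -- the marginal law and the marginal density of the data of a category
    (∀ k,
      marginalDataLaw (N k) (η k) (Ψ k) (ν k) =
        matrixTLaw (ν k + 1 - p) (constRows (N k) (η k)) (1 + onesMatrix (N k) (N k)) (Ψ k) ∧
      ∀ Y : Matrix (Fin (N k)) (Fin p) ℝ,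
        marginalLikelihood (η k) (Ψ k) (ν k) Y =
          ENNReal.ofReal (matrixTPDF (ν k + 1 - p) (constRows (N k) (η k))
            (1 + onesMatrix (N k) (N k)) (Ψ k) Y)) ∧
    -- the predictive law of a full, or partial, new observation of a category
    (∀ k, ∀ Y : Matrix (Fin (N k)) (Fin p) ℝ,
      predictiveLaw (η k) (Ψ k) (ν k) Y =
        multivariateTLaw (N k + ν k + 1 - p) (predictiveLocation (η k) Y)
          (predictiveScale (η k) (Ψ k) (ν k) Y) ∧
      ∀ (q : ℕ) (e : Fin q ↪ Fin p),
        (predictiveLaw (η k) (Ψ k) (ν k) Y).map (fun y j => y (e j)) =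
          multivariateTLaw (N k + ν k + 1 - p) (fun j => predictiveLocation (η k) Y (e j))
            ((predictiveScale (η k) (Ψ k) (ν k) Y).submatrix e e)) ∧
    ∀ Y : (k : Fin K) → Matrix (Fin (N k)) (Fin p) ℝ,
      -- the joint posterior factorizes, with a Dirichlet posterior for the category probabilities
      modelPosterior α η Ψ ν Y =
        (dirichletLaw fun k => N k + α k).prod
          (Measure.pi fun k => niwPosterior (η k) (Ψ k) (ν k) (Y k)) ∧
      -- the predictive category probabilities
      (∀ k, (newEventPredictiveLaw α η Ψ ν Y).map Prod.fst {k} =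
        ENNReal.ofReal ((N k + α k) / ∑ j, (N j + α j))) ∧
      -- the law of a new event, given that it is of category `k`
      (∀ k, (ProbabilityTheory.cond (newEventPredictiveLaw α η Ψ ν Y)
          (Prod.fst ⁻¹' {k})).map Prod.snd =
        multivariateTLaw (N k + ν k + 1 - p) (predictiveLocation (η k) (Y k))
          (predictiveScale (η k) (Ψ k) (ν k) (Y k))) ∧
      -- the total predictive law of a full or partial new event
      ∀ (q : ℕ) (e : Fin q ↪ Fin p),
        (newEventPredictiveLaw α η Ψ ν Y).map (fun x j => x.2 (e j)) =
          ∑ k, ENNReal.ofReal ((N k + α k) / ∑ j, (N j + α j)) •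
            multivariateTLaw (N k + ν k + 1 - p)
              (fun j => predictiveLocation (η k) (Y k) (e j))
              ((predictiveScale (η k) (Ψ k) (ν k) (Y k)).submatrix e e) := by

  have hpost := fun k (Y : Matrix (Fin (N k)) (Fin p) ℝ) =>
    isProbabilityMeasure_niwPosterior (η k) (hΨ k) (hν k) Y
  have hpred := fun k (Y : Matrix (Fin (N k)) (Fin p) ℝ) =>
    predictiveLaw_eq_multivariateTLaw (η k) (hΨ k) (hν k) Y
  have hpart : ∀ k (Y : Matrix (Fin (N k)) (Fin p) ℝ) (q : ℕ) (e : Fin q ↪ Fin p),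
      (predictiveLaw (η k) (Ψ k) (ν k) Y).map (fun y j => y (e j)) =
        multivariateTLaw (N k + ν k + 1 - p) (fun j => predictiveLocation (η k) Y (e j))
          ((predictiveScale (η k) (Ψ k) (ν k) Y).submatrix e e) := by
    intro k Y q e
    have hn : (0 : ℝ) ≤ N k := Nat.cast_nonneg _
    have := hν k
    rw [hpred k Y, multivariateTLaw_map_comp (by linarith) _
      (posDef_predictiveScale (η k) (hΨ k) this Y)]
  refine ⟨fun k => ⟨marginalDataLaw_eq_matrixTLaw (η k) (hΨ k) (hν k), fun Y =>
    marginalLikelihood_eq_matrixTPDF (η k) (hΨ k) (hν k) Y⟩,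
    fun k Y => ⟨hpred k Y, hpart k Y⟩, fun Y => ⟨modelPosterior_eq η hK hα hΨ hν Y, ?_, ?_, ?_⟩⟩
  · intro k
    have h := newEventPredictiveLaw_fst_preimage_inter η hK hα hΨ hν Y k .univ
    have := hpost k (Y k)
    rw [Measure.map_apply measurable_fst (measurableSet_singleton k)]
    simpa using h
  · intro k
    have := hpost k (Y k)
    have hk : MeasurableSet (Prod.fst ⁻¹' {k} : Set (Fin K × (Fin p → ℝ))) :=
      measurable_fst (measurableSet_singleton k)
    -- The event that the category is `k` has its weight as mass, because the predictive law of the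
    -- category is a probability measure.
    have h1 := newEventPredictiveLaw_fst_preimage_inter η hK hα hΨ hν Y k .univ
    rw [measure_univ, mul_one, Set.preimage_univ, Set.inter_univ] at h1
    have hw : 0 < ((N k : ℝ) + α k) / ∑ j, ((N j : ℝ) + α j) := by
      have h0 : ∀ j, 0 < (N j : ℝ) + α j := fun j =>
        add_pos_of_nonneg_of_pos (Nat.cast_nonneg _) (hα j)
      exact div_pos (h0 k) (Finset.sum_pos (fun j _ => h0 j) ⟨k, Finset.mem_univ k⟩)
    rw [← hpred k (Y k)]
    ext t ht
    -- Conditioning divides by this weight, which is positive and finite and cancels against the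
    -- same factor in the joint law.
    rw [Measure.map_apply measurable_snd ht, cond_apply hk, h1,
      newEventPredictiveLaw_fst_preimage_inter η hK hα hΨ hν Y k ht, ← mul_assoc,
      ENNReal.inv_mul_cancel (ENNReal.ofReal_pos.2 hw).ne' ENNReal.ofReal_ne_top, one_mul]
  · intro q e
    have he : Measurable fun (y : Fin p → ℝ) (j : Fin q) => y (e j) := by fun_prop
    have he2 : Measurable fun (x : Fin K × (Fin p → ℝ)) (j : Fin q) => x.2 (e j) := by fun_prop
    ext t ht
    rw [Measure.map_apply he2 ht, newEventPredictiveLaw_apply η hK hα hΨ hν Y (he2 ht),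
      Measure.finsetSum_apply]
    refine Finset.sum_congr rfl fun k _ => ?_
    rw [Measure.smul_apply, ← hpart k (Y k), Measure.map_apply he ht, smul_eq_mul]
    rfl
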